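/- Let $n\ge 0$, $m\ge 0$, let $p_1,\dots,p_n\in\mathbb C$ be distinct, $p_0=\infty$, and let $P=p_0+p_1+\dots+p_n$ be the corresponding reduced divisor on $\mathbb P^1=\mathbb P^1_{\mathbb C}$. For each $j\in\{0,\dots,n\}$ let $\mu^j_1,\dots,\mu^j_m$ be pairwise distinct complex numbers. Let $(E,D)$ be any algebraic vector bundle $E$ of rank $m$ on $\mathbb P^1$ with a connection $D:E\to\Omega^1(P)\otimes E$ having at most logarithmic poles along $P$, such that for every $j$ the residue $\operatorname{res}(p_j,D)\in\operatorname{End}(E_{p_j})$ is conjugate to $\operatorname{diag}(\mu^j_1,\dots,\mu^j_m)$. (In particular $(E,D)$ may be any point of a moduli space $\mathcal M$ of parabolically stable logarithmic connections of fixed degree with these residue conjugacy classes; neither stability, nor the degree, nor a further genericity condition on the $\mu^j_k$ is needed.) Let $v^j_1,\dots,v^j_m$ be eigenvectors of $\operatorname{res}(p_j,D)$ for $\mu^j_1,\dots,\mu^j_m$ and, for $0\le k\le m$, let $V^j_k\subseteq E_{p_j}$ be the span of $v^j_{k+1},\dots,v^j_m$ (and $V^j_{m+1}=0$). Let $\mathcal{E}nd_{\rm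 par}(E)$ be the sheaf of endomorphisms $\varphi$ of $E$ such that $\varphi(p_j)$ maps $V^j_k$ into $V^j_k$ for all $j,k$, and $\mathcal{E}nd_{\rm iso}(E)$ the sheaf of endomorphisms $\varphi$ of $E$ such that $\varphi(p_j)$ maps $V^j_k$ into $V^j_{k+1}$ for all $j,k$. The action $\operatorname{ad}_D(\varphi)=D\circ\varphi-\varphi\circ D$ of $D$ on endomorphisms is a two-term complex of sheaves $$\mathcal{E}nd_{\rm par}(E)\xrightarrow{\ \operatorname{ad}_D\ }\Omega^1(P)\otimes\mathcal{E}nd_{\rm iso}(E),$$ and induces maps $$H^i(D):H^i(\mathbb P^1,\mathcal{E}nd_{\rm par}(E))\to H^i(\mathbb P^1,\Omega^1(P)\otimes\mathcal{E}nd_{\rm iso}(E)),\qquad i=0,1.$$ Put $C=\operatorname{coker}H^0(D)$ and $K=\ker H^1(D)$. Then Serre duality induces an isomorphism of complex vector spaces $K^\vee\cong C$. That is, the Serre duality pairing $$H^0(\mathbb P^1,\Omega^1(P)\otimes\mathcal{E}nd_{\rm iso}(E))\times H^1(\mathbb P^1,\mathcal{E}nd_{\rm par}(E))\to H^1(\mathbb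 P^1,\Omega^1)\cong\mathbb C,\qquad (\psi,[\varphi])\mapsto \operatorname{Res}_{z=0}\tfrac1m\operatorname{tr}(\psi\varphi)$$ (where classes in $H^1$ are represented by Čech cocycles on $\mathbb P^1\setminus\{0,\infty\}$ for the affine cover $\mathbb P^1\setminus\{\infty\},\ \mathbb P^1\setminus\{0\}$) restricts and descends to a pairing $C\times K\to\mathbb C$, and the induced $\mathbb C$-linear map $C\to K^\vee=\operatorname{Hom}_{\mathbb C}(K,\mathbb C)$ is bijective. -/

import Mathlib

namespace ProjLine

open Module

/-! ### The projective line over `ℂ` -/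

/-- The function field `ℂ(z)` of the projective line; `z` is `RatFunc.X`. -/
abbrev Fn : Type := RatFunc ℂ

/-- The closed points of the projective line: the affine points `a : ℂ` and the point at infinity. -/
abbrev Pt : Type := OnePoint ℂ

/-- The local ring of the projective line at a point, inside the function field: rational functions
whose reduced denominator does not vanish at `a`, respectively rational functions whose numerator
has degree at most the degree of the denominator. -/
noncomputable def localRing : Pt → Subalgebra ℂ Fn
  | OnePoint.infty =>
    { carrier := {f | f.intDegree ≤ 0}
      mul_mem' := by
        intro f g hf hg
        simp only [Set.mem_ofPred_eq] at *
        by_cases h1 : f = 0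
        · simp [h1]
        by_cases h2 : g = 0
        · simp [h2]
        rw [RatFunc.intDegree_mul h1 h2]
        omega
      add_mem' := by
        intro f g hf hg
        simp only [Set.mem_ofPred_eq] at *
        by_cases h1 : g = 0
        · simpa [h1] using hf
        by_cases h2 : f + g = 0
        · simp [h2]
        exact (RatFunc.intDegree_add_le h1 h2).trans (max_le hf hg)
      algebraMap_mem' := by
        intro c
        simp only [Set.mem_ofPred_eq]
        have : algebraMap ℂ Fn c = RatFunc.C c := rfl
        rw [this, RatFunc.intDegree_C] }
  | OnePoint.some a =>
    { carrier := {f | f.denom.eval a ≠ 0}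
      mul_mem' := by
        intro f g hf hg h
        obtain ⟨q, hq⟩ := RatFunc.denom_mul_dvd f g
        have := congrArg (Polynomial.eval a) hq
        rw [Polynomial.eval_mul, Polynomial.eval_mul, h, zero_mul] at this
        exact mul_ne_zero hf hg this
      add_mem' := by
        intro f g hf hg h
        obtain ⟨q, hq⟩ := RatFunc.denom_add_dvd f g
        have := congrArg (Polynomial.eval a) hq
        rw [Polynomial.eval_mul, Polynomial.eval_mul, h, zero_mul] at this
        exact mul_ne_zero hf hg this
      algebraMap_mem' := by
        intro c
        simp }

/-- The local coordinate at a point: `z - a` at `a`, and `ζ = 1/z` at infinity. -/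
noncomputable def coord : Pt → Fn
  | OnePoint.infty => RatFunc.X⁻¹
  | OnePoint.some a => RatFunc.X - RatFunc.C a

/-- The derivation `d/dz` of `ℂ(z)`, given by the quotient rule. -/
noncomputable def ddzFun (f : Fn) : Fn :=
  (algebraMap (Polynomial ℂ) Fn (Polynomial.derivative f.num) *
        algebraMap (Polynomial ℂ) Fn f.denom -
      algebraMap (Polynomial ℂ) Fn f.num *
        algebraMap (Polynomial ℂ) Fn (Polynomial.derivative f.denom)) /
    algebraMap (Polynomial ℂ) Fn f.denom ^ 2

lemma ddzFun_div (a b : Polynomial ℂ) (hb : b ≠ 0) :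
    ddzFun (algebraMap (Polynomial ℂ) Fn a / algebraMap (Polynomial ℂ) Fn b) =
      (algebraMap (Polynomial ℂ) Fn (Polynomial.derivative a) * algebraMap (Polynomial ℂ) Fn b -
        algebraMap (Polynomial ℂ) Fn a * algebraMap (Polynomial ℂ) Fn (Polynomial.derivative b)) /
      algebraMap (Polynomial ℂ) Fn b ^ 2 := by
  set f : Fn := algebraMap (Polynomial ℂ) Fn a / algebraMap (Polynomial ℂ) Fn b with hf
  have hd : f.denom ≠ 0 := RatFunc.denom_ne_zero f
  have hdm : algebraMap (Polynomial ℂ) Fn f.denom ≠ 0 := RatFunc.algebraMap_ne_zero hd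
  have hbm : algebraMap (Polynomial ℂ) Fn b ≠ 0 := RatFunc.algebraMap_ne_zero hb
  have h1 : f.num * b = a * f.denom := RatFunc.num_mul_eq_mul_denom_iff hb |>.2 rfl
  have h2 := congrArg Polynomial.derivative h1
  rw [Polynomial.derivative_mul, Polynomial.derivative_mul] at h2
  have h1' := congrArg (algebraMap (Polynomial ℂ) Fn) h1
  have h2' := congrArg (algebraMap (Polynomial ℂ) Fn) h2
  simp only [map_mul, map_add] at h1' h2'
  rw [ddzFun, div_eq_div_iff (pow_ne_zero 2 hdm) (pow_ne_zero 2 hbm)]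
  linear_combination
    (algebraMap (Polynomial ℂ) Fn f.denom * algebraMap (Polynomial ℂ) Fn b) * h2' -
      (algebraMap (Polynomial ℂ) Fn f.denom *
          algebraMap (Polynomial ℂ) Fn (Polynomial.derivative b) +
        algebraMap (Polynomial ℂ) Fn (Polynomial.derivative f.denom) *
          algebraMap (Polynomial ℂ) Fn b) * h1'

/-- The derivation `d/dz` of the function field. -/
noncomputable def ddz : Derivation ℂ Fn Fn :=
  Derivation.mk'
    { toFun := ddzFun
      map_add' := by
        intro f g
        induction f using RatFunc.induction_on with | _ a b hb =>
        induction g using RatFunc.induction_on with | _ c d hd =>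
        have hbm : algebraMap (Polynomial ℂ) Fn b ≠ 0 := RatFunc.algebraMap_ne_zero hb
        have hdm : algebraMap (Polynomial ℂ) Fn d ≠ 0 := RatFunc.algebraMap_ne_zero hd
        rw [div_add_div _ _ hbm hdm, ← map_mul, ← map_mul, ← map_mul, ← map_add,
          ddzFun_div _ _ (mul_ne_zero hb hd), ddzFun_div _ _ hb, ddzFun_div _ _ hd]
        simp only [Polynomial.derivative_mul, map_mul, map_add]
        field_simp
        ring
      map_smul' := by
        intro r f
        induction f using RatFunc.induction_on with | _ a b hb =>
        have hbm : algebraMap (Polynomial ℂ) Fn b ≠ 0 := RatFunc.algebraMap_ne_zero hb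
        have : r • (algebraMap (Polynomial ℂ) Fn a / algebraMap (Polynomial ℂ) Fn b) =
            algebraMap (Polynomial ℂ) Fn (Polynomial.C r * a) /
              algebraMap (Polynomial ℂ) Fn b := by
          rw [Algebra.smul_def, map_mul, mul_div_assoc]
          rfl
        rw [this, ddzFun_div _ _ hb, ddzFun_div _ _ hb, Algebra.smul_def]
        have hr : algebraMap ℂ Fn r = algebraMap (Polynomial ℂ) Fn (Polynomial.C r) := rfl
        simp only [Polynomial.derivative_mul, Polynomial.derivative_C, map_mul, zero_mul,
          zero_add, hr, RingHom.id_apply]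
        ring }
    (by
      intro f g
      simp only [LinearMap.coe_mk, AddHom.coe_mk, smul_eq_mul]
      induction f using RatFunc.induction_on with | _ a b hb =>
      induction g using RatFunc.induction_on with | _ c d hd =>
      have hbm : algebraMap (Polynomial ℂ) Fn b ≠ 0 := RatFunc.algebraMap_ne_zero hb
      have hdm : algebraMap (Polynomial ℂ) Fn d ≠ 0 := RatFunc.algebraMap_ne_zero hd
      rw [div_mul_div_comm, ← map_mul, ← map_mul,
        ddzFun_div _ _ (mul_ne_zero hb hd), ddzFun_div _ _ hb, ddzFun_div _ _ hd]
      simp only [Polynomial.derivative_mul, map_mul, map_add]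
      field_simp
      ring)

lemma ddz_X : ddz RatFunc.X = 1 := by
  change ddzFun RatFunc.X = 1
  simp [ddzFun]

/-- The coefficient `g` of the local generator `g ∂_z` of the tangent sheaf: `∂_z` at an affine
point and `∂_ζ = -z² ∂_z` at infinity. -/
noncomputable def tangentGen : Pt → Fn
  | OnePoint.infty => -RatFunc.X ^ 2
  | OnePoint.some _ => 1

lemma tangentGen_mul_ddz_coord (x : Pt) : tangentGen x * ddz (coord x) = 1 := by
  induction x using OnePoint.rec with
  | infty =>
    change -RatFunc.X ^ 2 * ddz (RatFunc.X⁻¹) = 1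
    have h0 : (RatFunc.X : Fn) ≠ 0 := RatFunc.X_ne_zero
    rw [Derivation.leibniz_inv, ddz_X]
    simp only [smul_eq_mul]
    field_simp
  | coe a =>
    change 1 * ddz (RatFunc.X - RatFunc.C a) = 1
    have : ddz (RatFunc.C a) = 0 := ddz.map_algebraMap a
    rw [map_sub, ddz_X, this]
    simp

open Classical in
/-- The coefficient `g` of the local generator `g ∂_z` of the sheaf of vector fields vanishing at
the points of `S`.  A rational form `f dz` is a local section at `x` of `Ω¹(S)` iff `g * f` is
regular at `x`. -/
noncomputable def logField (S : Set Pt) (x : Pt) : Fn :=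
  if x ∈ S then coord x * tangentGen x else tangentGen x

open scoped RatFunc in
/-- The residue at `z = 0` of the rational differential form `f dz`. -/
noncomputable def resZero (f : Fn) : ℂ := (algebraMap Fn (LaurentSeries ℂ) f).coeff (-1)

/-! ### Sheaves and Čech cohomology

A torsion-free sheaf on the projective line is given by its generic stalk `M` and by the subspaces
`G x ⊆ M` of germs at the points `x`; its sections over an open set `U` are the elements of `M` that
lie in `G x` for all `x ∈ U`. -/

section Cech

variable {M N : Type*} [AddCommGroup M] [Module ℂ M] [AddCommGroup N] [Module ℂ N]

/-- Sections over `U`. -/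
def sections (G : Pt → Submodule ℂ M) (U : Set Pt) : Submodule ℂ M := ⨅ x ∈ U, G x

/-- The affine open set where `z` is regular. -/
def chartZero : Set Pt := {OnePoint.infty}ᶜ

/-- The affine open set where `1/z` is regular. -/
def chartInfty : Set Pt := {((0 : ℂ) : OnePoint ℂ)}ᶜ

/-- `H⁰`: global sections. -/
abbrev H0 (G : Pt → Submodule ℂ M) : Type _ := sections G Set.univ

/-- Čech one-cochains for the affine cover `{chartZero, chartInfty}`: sections over the overlap. -/
abbrev Cech1 (G : Pt → Submodule ℂ M) : Type _ := sections G (chartZero ∩ chartInfty)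

/-- Čech one-coboundaries: differences of sections over the two charts. -/
def coboundaries (G : Pt → Submodule ℂ M) : Submodule ℂ (Cech1 G) :=
  (sections G chartZero ⊔ sections G chartInfty).submoduleOf (sections G (chartZero ∩ chartInfty))

/-- `H¹`, computed by the Čech complex of the affine cover `{chartZero, chartInfty}`. -/
abbrev H1 (G : Pt → Submodule ℂ M) : Type _ := Cech1 G ⧸ coboundaries G

variable {G : Pt → Submodule ℂ M} {G' : Pt → Submodule ℂ N}

lemma sections_le_comap (T : M →ₗ[ℂ] N) (h : ∀ x, ∀ s ∈ G x, T s ∈ G' x) (U : Set Pt) :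
    ∀ s ∈ sections G U, T s ∈ sections G' U := by
  intro s hs
  simp only [sections, Submodule.mem_iInf] at hs ⊢
  exact fun x hx => h x s (hs x hx)

/-- The map induced on `H⁰` by a morphism of sheaves of vector spaces. -/
def H0map (T : M →ₗ[ℂ] N) (h : ∀ x, ∀ s ∈ G x, T s ∈ G' x) : H0 G →ₗ[ℂ] H0 G' :=
  T.restrict (sections_le_comap T h Set.univ)

/-- The map induced on `H¹` by a morphism of sheaves of vector spaces. -/
def H1map (T : M →ₗ[ℂ] N) (h : ∀ x, ∀ s ∈ G x, T s ∈ G' x) : H1 G →ₗ[ℂ] H1 G' :=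
  (coboundaries G).mapQ (coboundaries G')
    (T.restrict (sections_le_comap T h (chartZero ∩ chartInfty)))
    (by
      rintro ⟨s, hs⟩ hs'
      simp only [coboundaries, Submodule.submoduleOf, Submodule.mem_comap,
        Submodule.subtype_apply, LinearMap.coe_restrict_apply] at hs' ⊢
      obtain ⟨a, ha, b, hb, rfl⟩ := Submodule.mem_sup.1 hs'
      rw [map_add]
      exact Submodule.add_mem_sup (sections_le_comap T h _ a ha) (sections_le_comap T h _ b hb))

end Cech

/-! ### Vector bundles -/

section Bundles

variable {V : Type*} [AddCommGroup V] [Module Fn V] [Module ℂ V] [IsScalarTower ℂ Fn V]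

/-- An algebraic vector bundle on the projective line with generic stalk `V`: a lattice
(finitely generated, spanning submodule over the local ring) in `V` for every point, which for all
but finitely many points is the lattice spanned by a fixed basis of `V`. -/
structure VectorBundle (V : Type*) [AddCommGroup V] [Module Fn V] where
  stalk : ∀ x : Pt, Submodule (localRing x) V
  fg : ∀ x, (stalk x).FG
  span_eq_top : ∀ x, Submodule.span Fn (stalk x : Set V) = ⊤
  generic : ∃ b : Basis (Fin (finrank Fn V)) Fn V,
    {x : Pt | stalk x ≠ Submodule.span (localRing x) (Set.range b)}.Finite

/-- Multiplication by a rational function, as a `ℂ`-linear map. -/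
noncomputable def mulBy (f : Fn) : V →ₗ[ℂ] V where
  toFun v := f • v
  map_add' := smul_add f
  map_smul' c v := smul_comm f c v

namespace VectorBundle

variable (E : VectorBundle V)

/-- The stalk as a complex vector space. -/
noncomputable def germ (x : Pt) : Submodule ℂ V := (E.stalk x).restrictScalars ℂ

/-- The germs that vanish at `x`. -/
noncomputable def vanishing (x : Pt) : Submodule ℂ V := (E.germ x).map (mulBy (coord x))

/-- The fibre `E_x`: germs modulo germs vanishing at `x`. -/
abbrev Fiber (x : Pt) : Type _ := E.germ x ⧸ (E.vanishing x).submoduleOf (E.germ x)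

/-- The germs whose value at `x` lies in a given subspace of the fibre. -/
noncomputable def germsIn (x : Pt) (W : Submodule ℂ (E.Fiber x)) : Submodule ℂ V :=
  (W.comap ((E.vanishing x).submoduleOf (E.germ x)).mkQ).map (E.germ x).subtype

variable {E}

lemma mem_germsIn {x : Pt} {W : Submodule ℂ (E.Fiber x)} {v : V} :
    v ∈ E.germsIn x W ↔ ∃ h : v ∈ E.germ x,
      ((E.vanishing x).submoduleOf (E.germ x)).mkQ ⟨v, h⟩ ∈ W := by
  simp [germsIn]

/-- The endomorphism of the fibre induced by a linear map that preserves the germs and the germs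
vanishing at the point. -/
noncomputable def fiberMap {x : Pt} (T : V →ₗ[ℂ] V) (h : ∀ v ∈ E.germ x, T v ∈ E.germ x)
    (h' : ∀ v ∈ E.vanishing x, T v ∈ E.vanishing x) : Module.End ℂ (E.Fiber x) :=
  ((E.vanishing x).submoduleOf (E.germ x)).mapQ ((E.vanishing x).submoduleOf (E.germ x))
    (T.restrict h) (fun v hv => h' v hv)

end VectorBundle

/-! ### Logarithmic connections -/

variable {ι : Type*}

/-- A connection on `E` with at most logarithmic poles at the points `q j`.  It is written
`D = nabla ⊗ dz` on the generic stalk; the last condition says that `D` maps the sheaf `E` to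
`Ω¹(P) ⊗ E`, where `P` is the set of the points `q j`. -/
structure LogConnection (E : VectorBundle V) (q : ι → Pt) where
  nabla : V →ₗ[ℂ] V
  leibniz : ∀ (f : Fn) (v : V), nabla (f • v) = ddz f • v + f • nabla v
  log : ∀ x, ∀ v ∈ E.germ x, logField (Set.range q) x • nabla v ∈ E.germ x

namespace LogConnection

variable {E : VectorBundle V} {q : ι → Pt} (D : LogConnection E q)

/-- The derivative along the local generator of the vector fields vanishing at the poles; at a pole
with local coordinate `t` this is the derivative along `t ∂_t`. -/
noncomputable def logDer (x : Pt) : V →ₗ[ℂ] V := mulBy (logField (Set.range q) x) ∘ₗ D.nabla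

lemma logDer_vanishing (j : ι) :
    ∀ v ∈ E.vanishing (q j), D.logDer (q j) v ∈ E.vanishing (q j) := by
  rintro _ ⟨v, hv, rfl⟩
  have hv' : v ∈ E.germ (q j) := hv
  refine ⟨v + D.logDer (q j) v, add_mem hv' (D.log _ v hv'), ?_⟩
  have h1 : logField (Set.range q) (q j) = coord (q j) * tangentGen (q j) := by
    simp [logField]
  have h2 := tangentGen_mul_ddz_coord (q j)
  simp only [logDer, mulBy, LinearMap.comp_apply, LinearMap.coe_mk, AddHom.coe_mk, D.leibniz,
    smul_add, smul_smul]
  have h3 : logField (Set.range q) (q j) * ddz (coord (q j)) = coord (q j) := by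
    rw [h1, mul_assoc, h2, mul_one]
  rw [h3, mul_comm (logField (Set.range q) (q j))]

/-- The residue of the connection at a pole, an endomorphism of the fibre. -/
noncomputable def residue (j : ι) : Module.End ℂ (E.Fiber (q j)) :=
  VectorBundle.fiberMap (D.logDer (q j)) (D.log (q j)) (D.logDer_vanishing j)

variable {m : ℕ} (μ : ι → Fin m → ℂ)

/-- The term `V^j_k` of the quasi-parabolic structure at `q j`: the span of the eigenvectors of the
residue for the eigenvalues `μ j l` with `l ≥ k` (indices `l` starting from `0`). -/
noncomputable def flag (j : ι) (k : ℕ) : Submodule ℂ (E.Fiber (q j)) :=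
  ⨆ (l : Fin m) (_ : k ≤ (l : ℕ)), (D.residue j).eigenspace (μ j l)

/-- Germs at `q j` whose value lies in `V^j_k`. -/
noncomputable def flagGerm (j : ι) (k : ℕ) : Submodule ℂ V := E.germsIn (q j) (D.flag μ j k)

/-- Endomorphisms of the generic stalk that map `A` into `B`. -/
noncomputable def mapsInto (A B : Submodule ℂ V) : Submodule ℂ (Module.End Fn V) where
  carrier := {φ | ∀ v ∈ A, φ v ∈ B}
  zero_mem' := fun v _ => by simp
  add_mem' := fun hf hg v hv => by simpa using add_mem (hf v hv) (hg v hv)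
  smul_mem' := fun c f hf v hv => by simpa using B.smul_mem c (hf v hv)

/-- The sheaf of parabolic endomorphisms: endomorphisms `φ` of `E` such that `φ(q j)` maps each
`V^j_k` into itself. -/
noncomputable def endPar (x : Pt) : Submodule ℂ (Module.End Fn V) :=
  mapsInto (E.germ x) (E.germ x) ⊓
    ⨅ (j : ι) (_ : q j = x) (k : ℕ), mapsInto (D.flagGerm μ j k) (D.flagGerm μ j k)

/-- The sheaf of locally isomonodromic endomorphisms: endomorphisms `φ` of `E` such that `φ(q j)`
maps each `V^j_k` into `V^j_{k+1}`. -/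
noncomputable def endIso (x : Pt) : Submodule ℂ (Module.End Fn V) :=
  mapsInto (E.germ x) (E.germ x) ⊓
    ⨅ (j : ι) (_ : q j = x) (k : ℕ), mapsInto (D.flagGerm μ j k) (D.flagGerm μ j (k + 1))

/-- The sheaf `Ω¹(P) ⊗ End_iso(E)`; the endomorphism `ψ` of the generic stalk stands for the
endomorphism-valued form `ψ dz`. -/
noncomputable def formsIso (x : Pt) : Submodule ℂ (Module.End Fn V) :=
  (D.endIso μ x).comap (mulBy (logField (Set.range q) x))

/-- The action of the connection on endomorphisms, `φ ↦ D ∘ φ - φ ∘ D` (divided by `dz`). -/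
noncomputable def ad : Module.End Fn V →ₗ[ℂ] Module.End Fn V where
  toFun φ :=
    { toFun := fun v => D.nabla (φ v) - φ (D.nabla v)
      map_add' := fun v w => by simp only [map_add]; abel
      map_smul' := fun f v => by
        simp only [map_smul, D.leibniz, map_add, RingHom.id_apply, smul_sub]
        abel }
  map_add' φ χ := by
    ext v
    simp only [LinearMap.add_apply, map_add, LinearMap.coe_mk, AddHom.coe_mk]
    abel
  map_smul' c φ := by
    ext v
    simp [smul_sub]

variable {D μ}

lemma flag_anti (j : ι) {k l : ℕ} (h : k ≤ l) : D.flag μ j l ≤ D.flag μ j k :=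
  iSup₂_le fun i hi => le_iSup₂_of_le i (h.trans hi) le_rfl

lemma residue_sub_mem (j : ι) (l : Fin m) (y : E.Fiber (q j)) (hy : y ∈ D.flag μ j l) :
    D.residue j y - μ j l • y ∈ D.flag μ j (l + 1) := by
  have : D.flag μ j l ≤ (D.flag μ j (l + 1)).comap
      (D.residue j - μ j l • (LinearMap.id : Module.End ℂ (E.Fiber (q j)))) := by
    refine iSup₂_le fun i hi z hz => ?_
    rw [Module.End.mem_eigenspace_iff] at hz
    simp only [Submodule.mem_comap, LinearMap.sub_apply, LinearMap.smul_apply, LinearMap.id_apply,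
      hz]
    rcases hi.eq_or_lt with h | h
    · rw [Fin.ext h, sub_self]
      exact zero_mem _
    · have hz' : z ∈ D.flag μ j (l + 1) :=
        (le_iSup₂_of_le (f := fun (l' : Fin m) (_ : (l : ℕ) + 1 ≤ (l' : ℕ)) =>
          (D.residue j).eigenspace (μ j l')) i h le_rfl)
          (Module.End.mem_eigenspace_iff.2 hz)
      exact sub_mem (Submodule.smul_mem _ _ hz') (Submodule.smul_mem _ _ hz')
  exact this hy

/-- The connection maps parabolic endomorphisms to `Ω¹(P) ⊗ End_iso(E)`. -/
lemma ad_mem (x : Pt) : ∀ φ ∈ D.endPar μ x, D.ad φ ∈ D.formsIso μ x := by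
  rintro φ ⟨hφ, hflag⟩
  have hφ' : ∀ v ∈ E.germ x, φ v ∈ E.germ x := hφ
  have key : ∀ v, (mulBy (logField (Set.range q) x) (D.ad φ)) v =
      D.logDer x (φ v) - φ (D.logDer x v) := by
    intro v
    simp [mulBy, ad, logDer, smul_sub]
  refine ⟨?_, ?_⟩
  · intro v hv
    rw [key]
    exact sub_mem (D.log x _ (hφ' v hv)) (hφ' _ (D.log x v hv))
  · simp only [SetLike.mem_coe, Submodule.mem_iInf] at hflag ⊢
    rintro j rfl k v hv
    rw [key]
    have hvan : ∀ v ∈ E.vanishing (q j), φ v ∈ E.vanishing (q j) := by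
      rintro _ ⟨w, hw, rfl⟩
      exact ⟨φ w, hφ' w hw, by simp [mulBy]⟩
    let φb : Module.End ℂ (E.Fiber (q j)) :=
      VectorBundle.fiberMap (φ.restrictScalars ℂ) hφ' hvan
    have hφb : ∀ l, ∀ y ∈ D.flag μ j l, φb y ∈ D.flag μ j l := by
      intro l y hy
      obtain ⟨⟨w, hw⟩, rfl⟩ := Submodule.mkQ_surjective _ y
      obtain ⟨_, h2⟩ := VectorBundle.mem_germsIn.1
        (hflag j rfl l w (VectorBundle.mem_germsIn.2 ⟨hw, hy⟩))
      exact h2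
    have hcomm : D.flag μ j k ≤ (D.flag μ j (k + 1)).comap
        (D.residue j ∘ₗ φb - φb ∘ₗ D.residue j) := by
      refine iSup₂_le fun l hl y hy => ?_
      have hy' : y ∈ D.flag μ j l :=
        (le_iSup₂_of_le (f := fun (l' : Fin m) (_ : (l : ℕ) ≤ (l' : ℕ)) =>
          (D.residue j).eigenspace (μ j l')) l le_rfl le_rfl) hy
      rw [Module.End.mem_eigenspace_iff] at hy
      simp only [Submodule.mem_comap, LinearMap.sub_apply, LinearMap.comp_apply, hy, map_smul]
      exact flag_anti j (Nat.succ_le_succ hl) (residue_sub_mem j l _ (hφb l y hy'))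
    obtain ⟨hv1, hv2⟩ := VectorBundle.mem_germsIn.1 hv
    refine VectorBundle.mem_germsIn.2
      ⟨sub_mem (D.log _ _ (hφ' v hv1)) (hφ' _ (D.log _ v hv1)), ?_⟩
    exact hcomm hv2

variable (D μ)

/-- The map `H⁰(D)`. -/
noncomputable def H0D : H0 (D.endPar μ) →ₗ[ℂ] H0 (D.formsIso μ) := H0map D.ad ad_mem

/-- The map `H¹(D)`. -/
noncomputable def H1D : H1 (D.endPar μ) →ₗ[ℂ] H1 (D.formsIso μ) := H1map D.ad ad_mem

/-- The cokernel `C` of `H⁰(D)`. -/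
noncomputable abbrev C : Type _ := H0 (D.formsIso μ) ⧸ LinearMap.range (D.H0D μ)

/-- The kernel `K` of `H¹(D)`. -/
noncomputable abbrev K : Submodule ℂ (H1 (D.endPar μ)) := LinearMap.ker (D.H1D μ)

end LogConnection

/-- The Serre duality pairing on representatives: a global section `ψ dz` of
`Ω¹(P) ⊗ End_iso(E)` and a Čech cocycle `φ` give the Čech cocycle `(1/m) tr(ψ φ) dz` of `Ω¹`, whose
class in `H¹(Ω¹) = ℂ` is its residue at `z = 0`. -/
noncomputable def serrePairing (m : ℕ) (ψ φ : Module.End Fn V) : ℂ :=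
  (1 / (m : ℂ)) * resZero (LinearMap.trace Fn V (ψ ∘ₗ φ))

end Bundles

/-- The poles `p_0 = ∞, p_1, …, p_n`. -/
def poles {n : ℕ} (p : Fin n → ℂ) : Fin (n + 1) → Pt :=
  Fin.cons OnePoint.infty fun j => (p j : OnePoint ℂ)

end ProjLine

/-!
Two facts carry the proof: Serre duality for lattices in a space of rational functions, and the
skew-adjointness of `φ ↦ D ∘ φ - φ ∘ D` under the residue of the trace form.

*Serre duality.*  Let `G` be the family of germs of a vector bundle inside its generic stalk `M`,
let `B` be a perfect form on `M`, and let `G'` consist at each point of the `ψ` for which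
`B ψ φ dz` is regular for all germs `φ` of `G`.  Then `H⁰(G')` is the full dual of `H¹(G)`
(`serreMap_injective`, `serreMap_surjective`), and no splitting of the bundle is needed to see it.
Given a functional `l` on `H¹(G)`, send a cocycle `φ` to the Laurent series
`∑ l (z ^ (-1 - k) φ) z ^ k`.  Since `z ^ j φ` extends over `0` for large `j` and over `∞` for
small `j`, this is a Laurent polynomial.  It is linear in `φ` over the Laurent polynomials, hence
extends to a linear functional on `M` and equals `B ψ φ` for some `ψ`; by construction its residue
is `l φ`.  That `l` vanishes on sections over the two charts says precisely that `ψ` is regular at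
`0` and at `∞` as well.

*Local duality.*  In a basis of the stalk of `E` lifting an eigenbasis of the residue at a pole, the
parabolic endomorphisms are the matrices with regular entries whose values at the pole vanish above
the diagonal, and for the locally isomonodromic ones the values vanish on the diagonal as well
(`exists_weights`).  Up to a twist by the pole these lattices are dual to each other under the trace
form (`hasRegularEntries_dual_iff`), so Serre duality applies to `End_par(E)` and
`Ω¹(P) ⊗ End_iso(E)` in both directions.

*Conclusion.*  As `tr (D φ)` is the derivative of `tr φ` and exact forms have no residue,
`H⁰(D)` is, up to sign, the transpose of `H¹(D)` (`resZero_trace_ad_comp`).  A functional on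
`H¹(End_par(E))` vanishes on the kernel of `H¹(D)` iff it factors through `H¹(D)`, hence iff it is
given by an element of the image of `H⁰(D)` (`exists_coker_equiv_dual_ker`).
-/

/-! ### Local rings of the projective line -/

namespace ProjLine

open Module

lemma mem_localRing_coe {a : ℂ} {f : Fn} :
    f ∈ localRing (a : OnePoint ℂ) ↔ f.denom.eval a ≠ 0 := Iff.rfl

lemma mem_localRing_infty {f : Fn} : f ∈ localRing OnePoint.infty ↔ f.intDegree ≤ 0 := Iff.rfl

lemma div_mem_localRing {a : ℂ} (p q : Polynomial ℂ) (hq : q.eval a ≠ 0) :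
    algebraMap (Polynomial ℂ) Fn p / algebraMap (Polynomial ℂ) Fn q ∈
      localRing (a : OnePoint ℂ) := by
  rw [mem_localRing_coe]
  intro h
  have hq0 : q ≠ 0 := by rintro rfl; simp at hq
  obtain ⟨r, hr⟩ := RatFunc.denom_div_dvd p q
  have := congrArg (Polynomial.eval a) hr
  rw [Polynomial.eval_mul, h, zero_mul] at this
  exact hq this

lemma algebraMap_mem_localRing (a : ℂ) (p : Polynomial ℂ) :
    algebraMap (Polynomial ℂ) Fn p ∈ localRing (a : OnePoint ℂ) := by
  simpa using div_mem_localRing (a := a) p 1 (by simp)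

lemma C_mem_localRing (x : Pt) (c : ℂ) : RatFunc.C c ∈ localRing x :=
  (localRing x).algebraMap_mem c

lemma coord_ne_zero (x : Pt) : coord x ≠ 0 := by
  intro h
  have := tangentGen_mul_ddz_coord x
  simp [h] at this

lemma tangentGen_ne_zero (x : Pt) : tangentGen x ≠ 0 := by
  intro h
  have := tangentGen_mul_ddz_coord x
  simp [h] at this

lemma coord_infty : coord OnePoint.infty = RatFunc.X⁻¹ := rfl

lemma coord_coe (a : ℂ) : coord (a : OnePoint ℂ) =
    algebraMap (Polynomial ℂ) Fn (Polynomial.X - Polynomial.C a) := by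
  simp [coord, RatFunc.algebraMap_X, RatFunc.algebraMap_C]

lemma coord_mem_localRing (x : Pt) : coord x ∈ localRing x := by
  induction x using OnePoint.rec with
  | infty =>
    rw [mem_localRing_infty]
    simp [coord, RatFunc.intDegree_inv]
  | coe a => rw [coord_coe]; exact algebraMap_mem_localRing _ _

lemma coord_inv_not_mem_localRing (x : Pt) : (coord x)⁻¹ ∉ localRing x := by
  induction x using OnePoint.rec with
  | infty =>
    rw [mem_localRing_infty]
    simp [coord]
  | coe a =>
    rw [coord_coe]
    intro h
    have h2 : (Polynomial.X - Polynomial.C a : Polynomial ℂ) ≠ 0 := Polynomial.X_sub_C_ne_zero a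
    have h3 := (RatFunc.num_mul_eq_mul_denom_iff
      (x := (algebraMap (Polynomial ℂ) Fn (Polynomial.X - Polynomial.C a))⁻¹) (p := 1) h2).2
      (by simp)
    have := congrArg (Polynomial.eval a) h3
    simp only [Polynomial.eval_mul, Polynomial.eval_sub, Polynomial.eval_X, Polynomial.eval_C,
      sub_self, mul_zero, one_mul] at this
    exact h this.symm

/-- The local ring is a discrete valuation ring with uniformizer `coord x`. -/
lemma exists_eq_coord_zpow_mul (x : Pt) {f : Fn} (hf : f ≠ 0) :
    ∃ (n : ℤ) (u : Fn), u ∈ localRing x ∧ u⁻¹ ∈ localRing x ∧ f = coord x ^ n * u := by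
  induction x using OnePoint.rec with
  | infty =>
    have hX : (RatFunc.X : Fn) ≠ 0 := RatFunc.X_ne_zero
    have hz : ∀ n : ℤ, ((RatFunc.X : Fn) ^ n).intDegree = n := by
      have hnat : ∀ n : ℕ, ((RatFunc.X : Fn) ^ n).intDegree = n := by
        intro n
        induction n with
        | zero => simp
        | succ n ih =>
          rw [pow_succ, RatFunc.intDegree_mul (pow_ne_zero _ hX) hX, ih, RatFunc.intDegree_X]
          simp
      intro n
      obtain ⟨k, rfl | rfl⟩ := n.eq_nat_or_neg
      · rw [zpow_natCast, hnat]
      · rw [zpow_neg, zpow_natCast, RatFunc.intDegree_inv, hnat]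
    have h1 : (RatFunc.X ^ (-f.intDegree) * f).intDegree = 0 := by
      rw [RatFunc.intDegree_mul (zpow_ne_zero _ hX) hf, hz]; ring
    refine ⟨-f.intDegree, RatFunc.X ^ (-f.intDegree) * f, ?_, ?_, ?_⟩
    · rw [mem_localRing_infty, h1]
    · rw [mem_localRing_infty, RatFunc.intDegree_inv, h1, neg_zero]
    · rw [coord_infty, inv_zpow, ← mul_assoc, inv_mul_cancel₀ (zpow_ne_zero _ hX), one_mul]
  | coe a =>
    have key : ∀ p : Polynomial ℂ, p ≠ 0 → ∃ (n : ℕ) (q : Polynomial ℂ), q.eval a ≠ 0 ∧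
        p = (Polynomial.X - Polynomial.C a) ^ n * q := by
      intro p hp
      obtain ⟨q, hq, hq'⟩ := Polynomial.exists_eq_pow_rootMultiplicity_mul_and_not_dvd p hp a
      exact ⟨_, q, fun h => hq' (Polynomial.dvd_iff_isRoot.2 h), hq⟩
    obtain ⟨k, p, hp, hk⟩ := key f.num (RatFunc.num_ne_zero hf)
    obtain ⟨l, q, hq, hl⟩ := key f.denom (RatFunc.denom_ne_zero f)
    have hc := coord_ne_zero (a : OnePoint ℂ)
    have hq0 : algebraMap (Polynomial ℂ) Fn q ≠ 0 := by
      apply RatFunc.algebraMap_ne_zero; rintro rfl; simp at hq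
    refine ⟨(k : ℤ) - l, algebraMap (Polynomial ℂ) Fn p / algebraMap (Polynomial ℂ) Fn q,
      div_mem_localRing _ _ hq, ?_, ?_⟩
    · rw [inv_div]; exact div_mem_localRing _ _ hp
    · conv_lhs => rw [← RatFunc.num_div_denom f, hk, hl]
      simp only [map_mul, map_pow, ← coord_coe]
      rw [zpow_sub₀ hc, zpow_natCast, zpow_natCast]
      field_simp

lemma coord_zpow_mem_localRing_iff (x : Pt) (n : ℤ) : coord x ^ n ∈ localRing x ↔ 0 ≤ n := by
  constructor
  · intro h
    by_contra hn
    obtain ⟨k, hk⟩ : ∃ k : ℕ, n = -1 - k := ⟨(-1 - n).toNat, by omega⟩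
    apply coord_inv_not_mem_localRing x
    have : (coord x)⁻¹ = coord x ^ n * coord x ^ k := by
      rw [← zpow_natCast, ← zpow_add₀ (coord_ne_zero x), hk]; simp
    rw [this]
    exact mul_mem h (pow_mem (coord_mem_localRing x) k)
  · intro h
    lift n to ℕ using h
    rw [zpow_natCast]
    exact pow_mem (coord_mem_localRing x) n

lemma mem_or_inv_mem_localRing (x : Pt) (f : Fn) : f ∈ localRing x ∨ f⁻¹ ∈ localRing x := by
  by_cases hf : f = 0
  · left; rw [hf]; exact zero_mem _
  obtain ⟨n, u, hu, hu', rfl⟩ := exists_eq_coord_zpow_mul x hf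
  rcases le_total 0 n with hn | hn
  · exact Or.inl (mul_mem ((coord_zpow_mem_localRing_iff x n).2 hn) hu)
  · right
    rw [mul_inv, ← zpow_neg]
    exact mul_mem ((coord_zpow_mem_localRing_iff x (-n)).2 (by omega)) hu'

lemma exists_coord_pow_mul_mem (x : Pt) (f : Fn) : ∃ N : ℕ, coord x ^ N * f ∈ localRing x := by
  by_cases hf : f = 0
  · exact ⟨0, by rw [hf, mul_zero]; exact zero_mem _⟩
  obtain ⟨n, u, hu, hu', rfl⟩ := exists_eq_coord_zpow_mul x hf
  refine ⟨(-n).toNat, ?_⟩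
  rw [← mul_assoc, ← zpow_natCast, ← zpow_add₀ (coord_ne_zero x)]
  exact mul_mem ((coord_zpow_mem_localRing_iff x _).2 (by omega)) hu

lemma finite_not_mem_localRing (f : Fn) : {x : Pt | f ∉ localRing x}.Finite := by
  have h : {x : Pt | f ∉ localRing x} ⊆
      insert OnePoint.infty ((fun a : ℂ => (a : OnePoint ℂ)) '' {a | f.denom.IsRoot a}) := by
    intro x hx
    induction x using OnePoint.rec with
    | infty => exact Or.inl rfl
    | coe a =>
      right
      refine ⟨a, ?_, rfl⟩
      by_contra h
      exact hx h
  refine Set.Finite.subset (Set.Finite.insert _ (Set.Finite.image _ ?_)) h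
  exact Polynomial.finite_setOfPred_isRoot (RatFunc.denom_ne_zero f)

lemma C_mem_coord_mul {x : Pt} {c : ℂ} {g : Fn} (hg : g ∈ localRing x)
    (h : RatFunc.C c = coord x * g) : c = 0 := by
  by_contra hc
  apply coord_inv_not_mem_localRing x
  have hC : RatFunc.C c ≠ (0 : Fn) := by simpa using hc
  have : (coord x)⁻¹ = g * RatFunc.C (c⁻¹) := by
    rw [map_inv₀]
    have := coord_ne_zero x
    field_simp
    rw [h]
  rw [this]
  exact mul_mem hg (C_mem_localRing x _)

instance (x : Pt) : ValuationRing (localRing x) where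
  cond' a b := by
    by_cases ha : a = 0
    · exact ⟨0, Or.inr (by simp [ha])⟩
    by_cases hb : b = 0
    · exact ⟨0, Or.inl (by simp [hb])⟩
    have ha' : (a : Fn) ≠ 0 := by simpa using ha
    have hb' : (b : Fn) ≠ 0 := by simpa using hb
    rcases mem_or_inv_mem_localRing x ((b : Fn) / a) with h | h
    · exact ⟨⟨_, h⟩, Or.inl (Subtype.ext (mul_div_cancel₀ _ ha'))⟩
    · rw [inv_div] at h
      exact ⟨⟨_, h⟩, Or.inr (Subtype.ext (mul_div_cancel₀ _ hb'))⟩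

/-- The local coordinate as an element of the local ring. -/
noncomputable def coordElt (x : Pt) : localRing x := ⟨coord x, coord_mem_localRing x⟩

lemma coordElt_mem_jacobson (x : Pt) :
    Ideal.span {coordElt x} ≤ (⊥ : Ideal (localRing x)).jacobson := by
  rw [IsLocalRing.jacobson_eq_maximalIdeal _ bot_ne_top, Ideal.span_le, Set.singleton_subset_iff,
    SetLike.mem_coe, IsLocalRing.mem_maximalIdeal, mem_nonunits_iff]
  rintro h
  obtain ⟨b, hb⟩ := h.exists_right_inv
  apply coord_inv_not_mem_localRing x
  have : coord x * (b : Fn) = 1 := congrArg Subtype.val hb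
  rw [← eq_inv_of_mul_eq_one_right this]
  exact b.2

end ProjLine

/-! ### Laurent expansions at zero -/

namespace ProjLine

open Module
open scoped LaurentSeries RatFunc

/-- The coefficient of `z ^ k` in the Laurent expansion at `z = 0`. -/
noncomputable def laurentCoeff (k : ℤ) : Fn →ₗ[ℂ] ℂ where
  toFun f := (algebraMap Fn (LaurentSeries ℂ) f).coeff k
  map_add' f g := by rw [map_add, HahnSeries.coeff_add]
  map_smul' c f := by
    rw [RatFunc.smul_eq_C_mul, map_mul, ← RatFunc.algebraMap_C,
      ← RatFunc.coePolynomial_eq_algebraMap, ← RatFunc.coe_coe, Polynomial.coe_C,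
      HahnSeries.ofPowerSeries_C, HahnSeries.C_mul_eq_smul]
    rfl

lemma resZero_eq_laurentCoeff (f : Fn) : resZero f = laurentCoeff (-1) f := rfl

lemma laurentCoeff_zpow_mul (j k : ℤ) (f : Fn) :
    laurentCoeff k (RatFunc.X ^ j * f) = laurentCoeff (k - j) f := by
  change (algebraMap Fn (LaurentSeries ℂ) (RatFunc.X ^ j * f)).coeff k = _
  rw [map_mul, map_zpow₀, RatFunc.coe_X, ← RatFunc.single_zpow,
    HahnSeries.coeff_single_mul, one_mul]
  rfl

lemma laurentCoeff_algebraMap_natCast (p : Polynomial ℂ) (n : ℕ) :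
    laurentCoeff n (algebraMap (Polynomial ℂ) Fn p) = p.coeff n := by
  change (algebraMap Fn (LaurentSeries ℂ) (algebraMap (Polynomial ℂ) Fn p)).coeff n = _
  rw [← RatFunc.coePolynomial_eq_algebraMap, ← RatFunc.coe_coe,
    HahnSeries.ofPowerSeries_apply_coeff]
  simp

lemma laurentCoeff_algebraMap_of_neg (p : Polynomial ℂ) {k : ℤ} (hk : k < 0) :
    laurentCoeff k (algebraMap (Polynomial ℂ) Fn p) = 0 := by
  change (algebraMap Fn (LaurentSeries ℂ) (algebraMap (Polynomial ℂ) Fn p)).coeff k = _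
  rw [← RatFunc.coePolynomial_eq_algebraMap, ← RatFunc.coe_coe, HahnSeries.ofPowerSeries_apply]
  apply HahnSeries.embDomain_of_notMem_range
  rintro ⟨n, hn⟩
  have : (n : ℤ) = k := hn
  omega

lemma eq_of_laurentCoeff_eq {f g : Fn} (h : ∀ k, laurentCoeff k f = laurentCoeff k g) : f = g := by
  apply (algebraMap Fn (LaurentSeries ℂ)).injective
  ext k
  exact h k

lemma coe_mem_overlap {a : ℂ} (ha : a ≠ 0) : (a : OnePoint ℂ) ∈ chartZero ∩ chartInfty := by
  constructor
  · exact OnePoint.coe_ne_infty a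
  · exact fun h => ha (OnePoint.coe_injective h)

lemma exists_polynomial_of_forall_mem {f : Fn} (h : ∀ x ∈ chartZero, f ∈ localRing x) :
    ∃ p : Polynomial ℂ, f = algebraMap (Polynomial ℂ) Fn p := by
  have h1 : f.denom.degree = 0 := by
    by_contra hd
    obtain ⟨a, ha⟩ := IsAlgClosed.exists_root f.denom hd
    exact h (a : OnePoint ℂ) (OnePoint.coe_ne_infty a) ha
  have h2 : f.denom = 1 := Polynomial.eq_one_of_monic_natDegree_zero (RatFunc.monic_denom f)
    (Polynomial.natDegree_eq_of_degree_eq_some h1)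
  refine ⟨f.num, ?_⟩
  conv_lhs => rw [← RatFunc.num_div_denom f, h2, map_one, div_one]

/-- A rational function that is regular outside `0` and `∞` is a Laurent polynomial. -/
lemma exists_eq_zpow_mul_polynomial {f : Fn} (h : ∀ x ∈ chartZero ∩ chartInfty, f ∈ localRing x) :
    ∃ (N : ℕ) (p : Polynomial ℂ),
      f = RatFunc.X ^ (-(N : ℤ)) * algebraMap (Polynomial ℂ) Fn p := by
  obtain ⟨N, hN⟩ := exists_coord_pow_mul_mem ((0 : ℂ) : OnePoint ℂ) f
  have hc : coord ((0 : ℂ) : OnePoint ℂ) = RatFunc.X := by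
    rw [coord_coe]; simp [RatFunc.algebraMap_X]
  obtain ⟨p, hp⟩ := exists_polynomial_of_forall_mem (f := RatFunc.X ^ N * f) (by
    intro x hx
    induction x using OnePoint.rec with
    | infty => exact absurd rfl hx
    | coe a =>
      by_cases ha : a = 0
      · rw [ha, ← hc]; exact hN
      · refine mul_mem (pow_mem ?_ N) (h _ (coe_mem_overlap ha))
        rw [← RatFunc.algebraMap_X]
        exact algebraMap_mem_localRing _ _)
  refine ⟨N, p, ?_⟩
  have hX : (RatFunc.X : Fn) ^ N ≠ 0 := pow_ne_zero _ RatFunc.X_ne_zero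
  rw [← hp, zpow_neg, zpow_natCast, inv_mul_cancel_left₀ hX]

lemma laurentCoeff_eq_zero_of_regular_chartZero {f : Fn} (h : ∀ x ∈ chartZero, f ∈ localRing x)
    {k : ℤ} (hk : k < 0) : laurentCoeff k f = 0 := by
  obtain ⟨p, rfl⟩ := exists_polynomial_of_forall_mem h
  exact laurentCoeff_algebraMap_of_neg p hk

lemma mem_localRing_zero_of_laurentCoeff {f : Fn}
    (h : ∀ x ∈ chartZero ∩ chartInfty, f ∈ localRing x) (hf : ∀ k < 0, laurentCoeff k f = 0) :
    f ∈ localRing ((0 : ℂ) : OnePoint ℂ) := by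
  obtain ⟨N, p, rfl⟩ := exists_eq_zpow_mul_polynomial h
  obtain ⟨q, rfl⟩ : Polynomial.X ^ N ∣ p := by
    rw [Polynomial.X_pow_dvd_iff]
    intro d hd
    have := hf ((d : ℤ) - N) (by omega)
    rwa [laurentCoeff_zpow_mul, show (d : ℤ) - N - -(N : ℤ) = (d : ℕ) by ring,
      laurentCoeff_algebraMap_natCast] at this
  have hX : (RatFunc.X : Fn) ^ N ≠ 0 := pow_ne_zero _ RatFunc.X_ne_zero
  rw [map_mul, map_pow, RatFunc.algebraMap_X, zpow_neg, zpow_natCast, inv_mul_cancel_left₀ hX]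
  exact algebraMap_mem_localRing _ _

lemma intDegree_X_zpow_mul_algebraMap (j : ℤ) {p : Polynomial ℂ} (hp : p ≠ 0) :
    (RatFunc.X ^ j * algebraMap (Polynomial ℂ) Fn p).intDegree = j + p.natDegree := by
  have hX : (RatFunc.X : Fn) ≠ 0 := RatFunc.X_ne_zero
  have hnat : ∀ n : ℕ, ((RatFunc.X : Fn) ^ n).intDegree = n := by
    intro n
    rw [← RatFunc.algebraMap_X, ← map_pow, RatFunc.intDegree_polynomial, Polynomial.natDegree_X_pow]
  rw [RatFunc.intDegree_mul (zpow_ne_zero _ hX) (RatFunc.algebraMap_ne_zero hp),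
    RatFunc.intDegree_polynomial]
  congr 1
  obtain ⟨k, rfl | rfl⟩ := j.eq_nat_or_neg
  · rw [zpow_natCast, hnat]
  · rw [zpow_neg, zpow_natCast, RatFunc.intDegree_inv, hnat]

/-- The form `f dz` is regular at infinity iff all Laurent coefficients of `f` from degree `-1`
onwards vanish. -/
lemma tangentGen_infty_mul_mem_iff {f : Fn}
    (h : ∀ x ∈ chartZero ∩ chartInfty, f ∈ localRing x) :
    tangentGen OnePoint.infty * f ∈ localRing OnePoint.infty ↔
      ∀ k ≥ -1, laurentCoeff k f = 0 := by
  obtain ⟨N, p, rfl⟩ := exists_eq_zpow_mul_polynomial h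
  have h1 : tangentGen OnePoint.infty *
      (RatFunc.X ^ (-(N : ℤ)) * algebraMap (Polynomial ℂ) Fn p) =
      RatFunc.X ^ (2 - (N : ℤ)) * algebraMap (Polynomial ℂ) Fn (-p) := by
    change -RatFunc.X ^ 2 * _ = _
    rw [sub_eq_add_neg, zpow_add₀ RatFunc.X_ne_zero, map_neg, ← zpow_natCast]
    push_cast
    ring
  rw [h1, mem_localRing_infty]
  by_cases hp : p = 0
  · simp [hp]
  rw [intDegree_X_zpow_mul_algebraMap _ (neg_ne_zero.2 hp), Polynomial.natDegree_neg]
  constructor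
  · intro hd k hk
    rw [laurentCoeff_zpow_mul]
    rcases lt_or_ge (k - -(N : ℤ)) 0 with hneg | hpos
    · exact laurentCoeff_algebraMap_of_neg p hneg
    · obtain ⟨n, hn⟩ := Int.eq_ofNat_of_zero_le hpos
      rw [hn]
      refine (laurentCoeff_algebraMap_natCast p n).trans
        (Polynomial.coeff_eq_zero_of_natDegree_lt ?_)
      omega
  · intro hc
    by_contra hd
    have := hc ((p.natDegree : ℤ) - N) (by omega)
    rw [laurentCoeff_zpow_mul, show (p.natDegree : ℤ) - N - -(N : ℤ) = (p.natDegree : ℕ) by ring,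
      laurentCoeff_algebraMap_natCast] at this
    exact hp (Polynomial.leadingCoeff_eq_zero.1 this)

lemma X_zpow_mem_localRing (j : ℤ) {x : Pt} (hx : x ∈ chartZero ∩ chartInfty) :
    (RatFunc.X : Fn) ^ j ∈ localRing x := by
  induction x using OnePoint.rec with
  | infty => exact absurd rfl hx.1
  | coe a =>
    have ha : a ≠ 0 := by rintro rfl; exact hx.2 rfl
    have h1 : (RatFunc.X : Fn) ∈ localRing (a : OnePoint ℂ) := by
      rw [← RatFunc.algebraMap_X]; exact algebraMap_mem_localRing _ _
    have h2 : (RatFunc.X : Fn)⁻¹ ∈ localRing (a : OnePoint ℂ) := by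
      have := div_mem_localRing (a := a) 1 Polynomial.X (by simpa using ha)
      rwa [map_one, RatFunc.algebraMap_X, one_div] at this
    obtain ⟨k, rfl | rfl⟩ := j.eq_nat_or_neg
    · rw [zpow_natCast]; exact pow_mem h1 k
    · rw [zpow_neg, zpow_natCast, ← inv_pow]; exact pow_mem h2 k

lemma exists_laurentCoeff_eq (c : ℤ → ℂ) (hc : c.support.Finite) :
    ∃ f : Fn, (∀ x ∈ chartZero ∩ chartInfty, f ∈ localRing x) ∧ ∀ k, laurentCoeff k f = c k := by
  refine ⟨∑ j ∈ hc.toFinset, c j • (RatFunc.X ^ j : Fn), fun x hx => ?_, fun k => ?_⟩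
  · exact sum_mem fun j _ => (localRing x).smul_mem (X_zpow_mem_localRing j hx) _
  · have h1 : ∀ j, laurentCoeff k (RatFunc.X ^ j) = if k = j then 1 else 0 := by
      intro j
      rw [← mul_one (RatFunc.X ^ j), laurentCoeff_zpow_mul,
        ← map_one (algebraMap (Polynomial ℂ) Fn)]
      split_ifs with h
      · rw [h, sub_self]
        simpa using laurentCoeff_algebraMap_natCast 1 0
      · rcases lt_or_ge (k - j) 0 with hneg | hpos
        · exact laurentCoeff_algebraMap_of_neg _ hneg
        · obtain ⟨n, hn⟩ := Int.eq_ofNat_of_zero_le hpos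
          rw [hn]
          refine (laurentCoeff_algebraMap_natCast 1 n).trans ?_
          rw [Polynomial.coeff_one, if_neg]
          omega
    simp only [map_sum, map_smul, h1, smul_eq_mul, mul_ite, mul_one, mul_zero]
    simp only [Finset.sum_ite_eq, Set.Finite.mem_toFinset, Function.mem_support]
    split_ifs with h
    · rfl
    · exact (not_not.1 h).symm

/-- An exact form has no residue. -/
lemma resZero_ddz {f : Fn} (h : ∀ x ∈ chartZero ∩ chartInfty, f ∈ localRing x) :
    resZero (ddz f) = 0 := by
  obtain ⟨N, p, rfl⟩ := exists_eq_zpow_mul_polynomial h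
  have hX : (RatFunc.X : Fn) ≠ 0 := RatFunc.X_ne_zero
  have h1 : ddz (RatFunc.X ^ (-(N : ℤ)) * algebraMap (Polynomial ℂ) Fn p) =
      RatFunc.X ^ (-(N : ℤ)) * algebraMap (Polynomial ℂ) Fn (Polynomial.derivative p) -
      (N : ℂ) • (RatFunc.X ^ (-(N : ℤ) - 1) * algebraMap (Polynomial ℂ) Fn p) := by
    have h2 : RatFunc.X ^ (-(N : ℤ)) * algebraMap (Polynomial ℂ) Fn p =
        algebraMap (Polynomial ℂ) Fn p / algebraMap (Polynomial ℂ) Fn (Polynomial.X ^ N) := by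
      rw [map_pow, RatFunc.algebraMap_X, zpow_neg, zpow_natCast, div_eq_mul_inv, mul_comm]
    have h3 : ddz (algebraMap (Polynomial ℂ) Fn p / algebraMap (Polynomial ℂ) Fn (Polynomial.X ^ N))
        = _ := ddzFun_div p (Polynomial.X ^ N) (pow_ne_zero _ Polynomial.X_ne_zero)
    rw [h2, h3, Algebra.smul_def, RatFunc.algebraMap_eq_C, map_natCast, zpow_sub₀ hX, zpow_neg,
      zpow_natCast, zpow_one]
    cases N with
    | zero => simp
    | succ N =>
      simp only [Polynomial.derivative_X_pow, map_mul, map_pow, RatFunc.algebraMap_X,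
        map_natCast, Nat.add_sub_cancel]
      field_simp
      ring
  rw [resZero_eq_laurentCoeff, h1, map_sub, map_smul, laurentCoeff_zpow_mul, laurentCoeff_zpow_mul]
  cases N with
  | zero =>
    have := laurentCoeff_algebraMap_of_neg (Polynomial.derivative p) (k := -1) (by omega)
    simpa using this
  | succ N =>
    rw [show (-1 : ℤ) - -((N + 1 : ℕ) : ℤ) = (N : ℕ) by push_cast; ring,
      show (-1 : ℤ) - (-((N + 1 : ℕ) : ℤ) - 1) = (N + 1 : ℕ) by push_cast; ring,
      laurentCoeff_algebraMap_natCast, laurentCoeff_algebraMap_natCast,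
      Polynomial.coeff_derivative]
    simp
    ring

end ProjLine

/-! ### Lattice families and their sections -/

namespace ProjLine

open Module

section Families

variable {M : Type*} [AddCommGroup M] [Module ℂ M]

lemma mem_sections {G : Pt → Submodule ℂ M} {U : Set Pt} {v : M} :
    v ∈ sections G U ↔ ∀ x ∈ U, v ∈ G x := by
  simp [sections]

lemma sections_mono (G : Pt → Submodule ℂ M) {U U' : Set Pt} (h : U' ⊆ U) :
    sections G U ≤ sections G U' :=
  fun _ hv => mem_sections.2 fun x hx => mem_sections.1 hv x (h hx)

lemma mk_eq_zero_of_mem_chartZero {G : Pt → Submodule ℂ M} {φ : Cech1 G}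
    (h : (φ : M) ∈ sections G chartZero) :
    (Submodule.Quotient.mk φ : H1 G) = 0 :=
  (Submodule.Quotient.mk_eq_zero _).2 (Submodule.mem_sup_left h)

lemma mk_eq_zero_of_mem_chartInfty {G : Pt → Submodule ℂ M} {φ : Cech1 G}
    (h : (φ : M) ∈ sections G chartInfty) :
    (Submodule.Quotient.mk φ : H1 G) = 0 :=
  (Submodule.Quotient.mk_eq_zero _).2 (Submodule.mem_sup_right h)

variable [Module Fn M]

/-- The family of germs of a torsion-free coherent sheaf of full rank: germs form modules over the
local rings, every element of the generic stalk becomes a germ at `x` after multiplication by a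
power of the coordinate at `x`, and is a germ at almost all points. -/
structure IsLatticeFamily (G : Pt → Submodule ℂ M) : Prop where
  smul_mem : ∀ x, ∀ f ∈ localRing x, ∀ v ∈ G x, f • v ∈ G x
  absorbs : ∀ x v, ∃ N : ℕ, coord x ^ N • v ∈ G x
  generic : ∀ v, {x | v ∉ G x}.Finite

variable {G : Pt → Submodule ℂ M}

/-- On an open set whose points `y` admit equations `t y` without other zeros, every element of the
generic stalk can be made a section by a factor that is invertible wherever the element was already
a germ. -/
lemma IsLatticeFamily.exists_smul_mem_sections (hG : IsLatticeFamily G) {U : Set Pt} (t : Pt → Fn)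
    (ht : ∀ y ∈ U, ∀ x ∈ U, t y ∈ localRing x)
    (ht' : ∀ y ∈ U, ∀ x ∈ U, y ≠ x → (t y)⁻¹ ∈ localRing x)
    (ht0 : ∀ y ∈ U, t y ≠ 0)
    (htc : ∀ y ∈ U, ∃ w ∈ localRing y, t y = w * coord y) (v : M) :
    ∃ s : Fn, s ≠ 0 ∧ s • v ∈ sections G U ∧ ∀ x ∈ U, v ∈ G x → s⁻¹ ∈ localRing x := by
  classical
  choose N hN using fun x => hG.absorbs x v
  set T : Finset Pt := ((hG.generic v).inter_of_left U).toFinset with hT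
  have hTU : ∀ y ∈ T, y ∈ U := fun y hy => by
    rw [hT, Set.Finite.mem_toFinset] at hy; exact hy.2
  -- `T` is the set of points of `U` where `v` is not a germ; the factor vanishes only there
  refine ⟨∏ y ∈ T, t y ^ N y, ?_, mem_sections.2 fun x hx => ?_, fun x hx hv => ?_⟩
  · exact Finset.prod_ne_zero_iff.2 fun y hy => pow_ne_zero _ (ht0 y (hTU y hy))
  · by_cases hxT : x ∈ T
    · rw [← Finset.mul_prod_erase T _ hxT]
      obtain ⟨w, hw, hwx⟩ := htc x hx
      rw [hwx, mul_pow, mul_comm (w ^ N x), mul_assoc, mul_comm, mul_smul]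
      refine hG.smul_mem x _ (mul_mem (pow_mem hw _) ?_) _ (hN x)
      exact prod_mem fun y hy => pow_mem (ht y (hTU y (Finset.mem_of_mem_erase hy)) x hx) _
    · refine hG.smul_mem x _ (prod_mem fun y hy => pow_mem (ht y (hTU y hy) x hx) _) _ ?_
      by_contra h
      exact hxT (by rw [hT, Set.Finite.mem_toFinset]; exact ⟨h, hx⟩)
  · rw [← Finset.prod_inv_distrib]
    refine prod_mem fun y hy => ?_
    rw [← inv_pow]
    refine pow_mem (ht' y (hTU y hy) x hx ?_) _
    rintro rfl
    rw [hT, Set.Finite.mem_toFinset] at hy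
    exact hy.1 hv

lemma inv_X_sub_C_mem_localRing {a b : ℂ} (h : a ≠ b) :
    (coord (a : OnePoint ℂ))⁻¹ ∈ localRing (b : OnePoint ℂ) := by
  have := div_mem_localRing (a := b) 1 (Polynomial.X - Polynomial.C a)
    (by simpa [sub_eq_zero] using h.symm)
  rwa [map_one, one_div, ← coord_coe] at this

lemma IsLatticeFamily.exists_smul_mem_sections_chartZero (hG : IsLatticeFamily G) (v : M) :
    ∃ s : Fn, s ≠ 0 ∧ s • v ∈ sections G chartZero ∧
      ∀ x ∈ chartZero, v ∈ G x → s⁻¹ ∈ localRing x := by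
  refine hG.exists_smul_mem_sections coord ?_ ?_ (fun y _ => coord_ne_zero y)
    (fun y _ => ⟨1, one_mem _, (one_mul _).symm⟩) v
  · intro y hy x hx
    induction x using OnePoint.rec with
    | infty => exact absurd rfl hx
    | coe b =>
      induction y using OnePoint.rec with
      | infty => exact absurd rfl hy
      | coe a => rw [coord_coe]; exact algebraMap_mem_localRing _ _
  · intro y hy x hx hyx
    induction x using OnePoint.rec with
    | infty => exact absurd rfl hx
    | coe b =>
      induction y using OnePoint.rec with
      | infty => exact absurd rfl hy
      | coe a => exact inv_X_sub_C_mem_localRing fun h => hyx (by rw [h])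

lemma X_inv_mem_localRing {x : Pt} (hx : x ∈ chartInfty) : (RatFunc.X : Fn)⁻¹ ∈ localRing x := by
  induction x using OnePoint.rec with
  | infty => exact coord_mem_localRing OnePoint.infty
  | coe b =>
    have hb : b ≠ 0 := by rintro rfl; exact hx rfl
    have := X_zpow_mem_localRing (-1) (coe_mem_overlap hb)
    rwa [zpow_neg_one] at this

lemma IsLatticeFamily.exists_smul_mem_sections_chartInfty (hG : IsLatticeFamily G) (v : M) :
    ∃ s : Fn, s ≠ 0 ∧ s • v ∈ sections G chartInfty ∧
      ∀ x ∈ chartInfty, v ∈ G x → s⁻¹ ∈ localRing x := by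
  classical
  have hX : (RatFunc.X : Fn) ≠ 0 := RatFunc.X_ne_zero
  -- the equation of the affine point `a` in this chart is `(z - a) / z`
  let t : Pt → Fn := fun y => if y = OnePoint.infty then coord y else coord y * RatFunc.X⁻¹
  have t_infty : t OnePoint.infty = RatFunc.X⁻¹ := by simp [t, coord_infty]
  have t_coe : ∀ a : ℂ, t a = coord a * RatFunc.X⁻¹ := by simp [t]
  refine hG.exists_smul_mem_sections t ?_ ?_ ?_ ?_ v
  · intro y hy x hx
    induction y using OnePoint.rec with
    | infty => rw [t_infty]; exact X_inv_mem_localRing hx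
    | coe a =>
      have h1 : coord (a : OnePoint ℂ) * RatFunc.X⁻¹ =
          1 - RatFunc.C a * RatFunc.X⁻¹ := by
        change (RatFunc.X - RatFunc.C a) * RatFunc.X⁻¹ = _
        field_simp
      rw [t_coe, h1]
      exact sub_mem (one_mem _) (mul_mem (C_mem_localRing _ _) (X_inv_mem_localRing hx))
  · intro y hy x hx hyx
    induction y using OnePoint.rec with
    | infty =>
      induction x using OnePoint.rec with
      | infty => exact absurd rfl hyx
      | coe b =>
        rw [t_infty, inv_inv, ← RatFunc.algebraMap_X]
        exact algebraMap_mem_localRing _ _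
    | coe a =>
      rw [t_coe, mul_inv, inv_inv]
      induction x using OnePoint.rec with
      | infty =>
        rw [mem_localRing_infty, coord_coe, ← RatFunc.algebraMap_X]
        rw [RatFunc.intDegree_mul (inv_ne_zero (by rw [← coord_coe]; exact coord_ne_zero _))
          (by rw [RatFunc.algebraMap_X]; exact hX), RatFunc.intDegree_inv,
          RatFunc.intDegree_polynomial, RatFunc.intDegree_polynomial]
        simp
      | coe b =>
        refine mul_mem (inv_X_sub_C_mem_localRing fun h => hyx (by rw [h])) ?_
        rw [← RatFunc.algebraMap_X]
        exact algebraMap_mem_localRing _ _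
  · intro y _
    induction y using OnePoint.rec with
    | infty => rw [t_infty]; exact inv_ne_zero hX
    | coe a => rw [t_coe]; exact mul_ne_zero (coord_ne_zero _) (inv_ne_zero hX)
  · intro y hy
    induction y using OnePoint.rec with
    | infty => exact ⟨1, one_mem _, by rw [t_infty, one_mul, coord_infty]⟩
    | coe a => exact ⟨_, X_inv_mem_localRing hy, by rw [t_coe, mul_comm]⟩

lemma X_mem_localRing {x : Pt} (hx : x ∈ chartZero) : (RatFunc.X : Fn) ∈ localRing x := by
  induction x using OnePoint.rec with
  | infty => exact absurd rfl hx
  | coe a => rw [← RatFunc.algebraMap_X]; exact algebraMap_mem_localRing _ _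

lemma coord_zero : coord ((0 : ℂ) : OnePoint ℂ) = RatFunc.X := by
  rw [coord_coe]; simp [RatFunc.algebraMap_X]

lemma zpow_smul_mem_chartZero (hG : IsLatticeFamily G) {v : M} (hv : v ∈ sections G chartZero)
    {j : ℤ} (hj : 0 ≤ j) : (RatFunc.X : Fn) ^ j • v ∈ sections G chartZero := by
  lift j to ℕ using hj
  rw [zpow_natCast]
  exact mem_sections.2 fun x hx =>
    hG.smul_mem x _ (pow_mem (X_mem_localRing hx) _) _ (mem_sections.1 hv x hx)

lemma zpow_smul_mem_chartInfty (hG : IsLatticeFamily G) {v : M} (hv : v ∈ sections G chartInfty)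
    {j : ℤ} (hj : j ≤ 0) : (RatFunc.X : Fn) ^ j • v ∈ sections G chartInfty := by
  obtain ⟨n, rfl⟩ : ∃ n : ℕ, j = -n := ⟨j.natAbs, by omega⟩
  rw [zpow_neg, zpow_natCast, ← inv_pow]
  exact mem_sections.2 fun x hx =>
    hG.smul_mem x _ (pow_mem (X_inv_mem_localRing hx) _) _ (mem_sections.1 hv x hx)

lemma exists_zpow_smul_mem_chartZero (hG : IsLatticeFamily G) (φ : Cech1 G) :
    ∃ N : ℕ, ∀ j : ℤ, N ≤ j → (RatFunc.X : Fn) ^ j • (φ : M) ∈ sections G chartZero := by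
  obtain ⟨N, hN⟩ := hG.absorbs ((0 : ℂ) : OnePoint ℂ) (φ : M)
  rw [coord_zero] at hN
  have h1 : (RatFunc.X : Fn) ^ N • (φ : M) ∈ sections G chartZero := mem_sections.2 fun x hx => by
    by_cases h : x ∈ chartInfty
    · exact hG.smul_mem x _ (pow_mem (X_mem_localRing hx) _) _ (mem_sections.1 φ.2 x ⟨hx, h⟩)
    · rw [not_not.1 h]; exact hN
  refine ⟨N, fun j hj => ?_⟩
  have := zpow_smul_mem_chartZero hG h1 (sub_nonneg.2 hj)
  rwa [smul_smul, ← zpow_natCast, ← zpow_add₀ RatFunc.X_ne_zero, sub_add_cancel] at this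

lemma exists_zpow_smul_mem_chartInfty (hG : IsLatticeFamily G) (φ : Cech1 G) :
    ∃ N : ℕ, ∀ j : ℤ, j ≤ -N → (RatFunc.X : Fn) ^ j • (φ : M) ∈ sections G chartInfty := by
  obtain ⟨N, hN⟩ := hG.absorbs OnePoint.infty (φ : M)
  rw [coord_infty] at hN
  have h1 : (RatFunc.X : Fn)⁻¹ ^ N • (φ : M) ∈ sections G chartInfty :=
    mem_sections.2 fun x hx => by
      by_cases h : x ∈ chartZero
      · exact hG.smul_mem x _ (pow_mem (X_inv_mem_localRing hx) _) _ (mem_sections.1 φ.2 x ⟨h, hx⟩)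
      · rw [not_not.1 h]; exact hN
  refine ⟨N, fun j hj => ?_⟩
  have := zpow_smul_mem_chartInfty hG h1 (j := j + N) (by omega)
  rwa [smul_smul, inv_pow, ← zpow_natCast, ← zpow_neg, ← zpow_add₀ RatFunc.X_ne_zero,
    add_neg_cancel_right] at this

variable [IsScalarTower ℂ Fn M]

/-- Multiplication of Čech cochains by a function that is regular on the overlap. -/
noncomputable def cechMul (hG : IsLatticeFamily G) (f : Fn)
    (hf : ∀ x ∈ chartZero ∩ chartInfty, f ∈ localRing x) : Cech1 G →ₗ[ℂ] Cech1 G :=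
  (mulBy f).restrict fun _ hv => mem_sections.2 fun x hx =>
    hG.smul_mem x f (hf x hx) _ (mem_sections.1 hv x hx)

lemma coe_cechMul (hG : IsLatticeFamily G) (f : Fn)
    (hf : ∀ x ∈ chartZero ∩ chartInfty, f ∈ localRing x) (φ : Cech1 G) :
    (cechMul hG f hf φ : M) = f • (φ : M) := rfl

end Families

end ProjLine

/-! ### Serre duality -/

namespace ProjLine

open Module

section Duality

variable {M : Type*} [AddCommGroup M] [Module Fn M] [Module ℂ M]
  {G G' : Pt → Submodule ℂ M}

/-- `G'` is the Serre dual of `G` with respect to a bilinear form `B` on the generic stalk: the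
elements of `G' x` stand for the forms `ψ dz` for which all `B ψ φ dz`, `φ ∈ G x`, are regular
at `x`. -/
def IsSerreDual (B : LinearMap.BilinForm Fn M) (G' G : Pt → Submodule ℂ M) : Prop :=
  ∀ x ψ, ψ ∈ G' x ↔ ∀ φ ∈ G x, tangentGen x * B ψ φ ∈ localRing x

variable {B : LinearMap.BilinForm Fn M}

lemma IsSerreDual.mem_of_coe (h : IsSerreDual B G' G) {x : Pt} (hx : x ∈ chartZero) {ψ φ : M}
    (hψ : ψ ∈ G' x) (hφ : φ ∈ G x) : B ψ φ ∈ localRing x := by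
  have := (h x ψ).1 hψ φ hφ
  induction x using OnePoint.rec with
  | infty => exact absurd rfl hx
  | coe a => rwa [show tangentGen (a : OnePoint ℂ) = 1 from rfl, one_mul] at this

lemma resZero_eq_zero_of_mem_chartZero (h : IsSerreDual B G' G) {ψ φ : M}
    (hψ : ψ ∈ sections G' Set.univ) (hφ : φ ∈ sections G chartZero) : resZero (B ψ φ) = 0 :=
  laurentCoeff_eq_zero_of_regular_chartZero
    (fun x hx => h.mem_of_coe hx (mem_sections.1 hψ x trivial) (mem_sections.1 hφ x hx))
    (by norm_num)

lemma resZero_eq_zero_of_mem_chartInfty (h : IsSerreDual B G' G) {ψ φ : M}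
    (hψ : ψ ∈ sections G' Set.univ) (hφ : φ ∈ sections G chartInfty) : resZero (B ψ φ) = 0 := by
  refine (tangentGen_infty_mul_mem_iff fun x hx => ?_).1 ?_ (-1) le_rfl
  · exact h.mem_of_coe hx.1 (mem_sections.1 hψ x trivial) (mem_sections.1 hφ x hx.2)
  · exact (h _ _).1 (mem_sections.1 hψ _ trivial) _
      (mem_sections.1 hφ _ (OnePoint.infty_ne_coe (0 : ℂ)))

variable [IsScalarTower ℂ Fn M]

/-- The pairing of global sections of the Serre dual with Čech cochains. -/
noncomputable def residuePairing (B : LinearMap.BilinForm Fn M) (G' G : Pt → Submodule ℂ M) :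
    H0 G' →ₗ[ℂ] Cech1 G →ₗ[ℂ] ℂ :=
  LinearMap.mk₂ ℂ (fun ψ φ => laurentCoeff (-1) (B (ψ : M) (φ : M)))
    (fun _ _ _ => by simp [map_add])
    (fun c ψ φ => by
      rw [Submodule.coe_smul, ← algebraMap_smul Fn c (ψ : M), map_smul, LinearMap.smul_apply,
        algebraMap_smul, map_smul])
    (fun _ _ _ => by simp [map_add])
    (fun c ψ φ => by
      rw [Submodule.coe_smul, ← algebraMap_smul Fn c (φ : M), map_smul,
        algebraMap_smul, map_smul])

lemma residuePairing_apply (ψ : H0 G') (φ : Cech1 G) :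
    residuePairing B G' G ψ φ = resZero (B (ψ : M) (φ : M)) := rfl

/-- The map from global sections of the Serre dual to the dual of `H¹`. -/
noncomputable def serreMap (h : IsSerreDual B G' G) : H0 G' →ₗ[ℂ] Dual ℂ (H1 G) where
  toFun ψ := (coboundaries G).liftQ (residuePairing B G' G ψ) (by
    rintro ⟨φ, hφ⟩ hφ'
    obtain ⟨a, ha, b, hb, rfl⟩ := Submodule.mem_sup.1 hφ'
    rw [LinearMap.mem_ker, residuePairing_apply, map_add, resZero_eq_laurentCoeff, map_add,
      ← resZero_eq_laurentCoeff, ← resZero_eq_laurentCoeff,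
      resZero_eq_zero_of_mem_chartZero h ψ.2 ha, resZero_eq_zero_of_mem_chartInfty h ψ.2 hb,
      add_zero])
  map_add' ψ χ := by
    apply Submodule.linearMap_qext
    ext φ
    simp [Submodule.liftQ_apply]
  map_smul' c ψ := by
    apply Submodule.linearMap_qext
    ext φ
    simp [Submodule.liftQ_apply]

lemma serreMap_apply (h : IsSerreDual B G' G) (ψ : H0 G') (φ : Cech1 G) :
    serreMap h ψ (Submodule.Quotient.mk φ) = resZero (B (ψ : M) (φ : M)) := rfl

lemma serreMap_injective (h : IsSerreDual B G' G) (hG : IsLatticeFamily G)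
    (hB : Function.Injective B) : Function.Injective (serreMap h) := by
  rw [injective_iff_map_eq_zero]
  intro ψ hψ
  have hψ' : ∀ φ : Cech1 G, resZero (B (ψ : M) (φ : M)) = 0 := fun φ => by
    rw [← serreMap_apply h, hψ]; rfl
  apply Subtype.ext
  apply hB
  ext v
  obtain ⟨s, hs, hsv, -⟩ := hG.exists_smul_mem_sections_chartZero v
  let φ : Cech1 G := ⟨s • v, sections_mono G Set.inter_subset_left hsv⟩
  have : B (ψ : M) (s • v) = 0 := by
    refine eq_of_laurentCoeff_eq fun k => ?_
    -- shift the coefficient in question to degree `-1`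
    have := hψ' (cechMul hG (RatFunc.X ^ (-1 - k)) (fun x hx => X_zpow_mem_localRing _ hx) φ)
    rw [coe_cechMul, map_smul, smul_eq_mul, resZero_eq_laurentCoeff, laurentCoeff_zpow_mul,
      sub_sub_cancel] at this
    rw [this, map_zero]
  rw [map_smul, smul_eq_zero_iff_right hs] at this
  simpa using this

/-- A functional on `H¹` is the degree `-1` coefficient of a Laurent polynomial depending linearly
on the cocycle: the other coefficients are obtained by multiplying the cocycle with powers of `z`,
and almost all of them vanish because high and low powers of `z` turn the cocycle into
a coboundary. -/
lemma exists_laurent_lift (hG : IsLatticeFamily G) (l : Dual ℂ (H1 G)) :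
    ∃ L : Cech1 G →ₗ[ℂ] Fn, (∀ φ, ∀ x ∈ chartZero ∩ chartInfty, L φ ∈ localRing x) ∧
      ∀ φ k, laurentCoeff k (L φ) = l (Submodule.Quotient.mk
        (cechMul hG (RatFunc.X ^ (-1 - k)) (fun _ hx => X_zpow_mem_localRing _ hx) φ)) := by
  have key : ∀ φ : Cech1 G, ∃ f : Fn, (∀ x ∈ chartZero ∩ chartInfty, f ∈ localRing x) ∧
      ∀ k, laurentCoeff k f = l (Submodule.Quotient.mk
        (cechMul hG (RatFunc.X ^ (-1 - k)) (fun _ hx => X_zpow_mem_localRing _ hx) φ)) := by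
    intro φ
    apply exists_laurentCoeff_eq
    obtain ⟨N, hN⟩ := exists_zpow_smul_mem_chartZero hG φ
    obtain ⟨N', hN'⟩ := exists_zpow_smul_mem_chartInfty hG φ
    refine (Set.finite_Icc (-1 - (N : ℤ)) N').subset fun k hk => ?_
    by_contra hk'
    apply hk
    rw [Set.mem_Icc, not_and_or] at hk'
    rcases hk' with h | h
    · dsimp only
      rw [mk_eq_zero_of_mem_chartZero (by rw [coe_cechMul]; exact hN _ (by omega)), map_zero]
    · dsimp only
      rw [mk_eq_zero_of_mem_chartInfty (by rw [coe_cechMul]; exact hN' _ (by omega)), map_zero]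
  choose L hL hL' using key
  refine ⟨⟨⟨L, fun φ χ => ?_⟩, fun c φ => ?_⟩, hL, hL'⟩
  · refine eq_of_laurentCoeff_eq fun k => ?_
    rw [hL', map_add, map_add, hL', hL', Submodule.Quotient.mk_add, map_add]
  · refine eq_of_laurentCoeff_eq fun k => ?_
    change laurentCoeff k (L (c • φ)) = laurentCoeff k (c • L φ)
    rw [hL', map_smul, map_smul, hL', Submodule.Quotient.mk_smul, map_smul]

/-- A map on cochains that commutes with multiplication by `z` extends to the generic stalk, since
the cochains contain a basis of it and coordinates in this basis have polynomial denominators. -/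
lemma exists_linear_extension [FiniteDimensional Fn M] (hG : IsLatticeFamily G)
    (L : Cech1 G →ₗ[ℂ] Fn)
    (hL : ∀ φ, L (cechMul hG RatFunc.X (fun _ hx => X_mem_localRing (Set.inter_subset_left hx)) φ) =
      RatFunc.X * L φ) :
    ∃ l : Dual Fn M, ∀ φ : Cech1 G, l (φ : M) = L φ := by
  have hreg : ∀ p : Polynomial ℂ, ∀ x ∈ chartZero ∩ chartInfty,
      algebraMap (Polynomial ℂ) Fn p ∈ localRing x := by
    intro p x hx
    induction x using OnePoint.rec with
    | infty => exact absurd rfl hx.1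
    | coe a => exact algebraMap_mem_localRing _ _
  have hpoly : ∀ (p : Polynomial ℂ) (φ : Cech1 G),
      L (cechMul hG (algebraMap (Polynomial ℂ) Fn p) (hreg p) φ) =
        algebraMap (Polynomial ℂ) Fn p * L φ := by
    intro p φ
    induction p using Polynomial.induction_on' with
    | add p q hp hq =>
      have h1 : cechMul hG (algebraMap (Polynomial ℂ) Fn (p + q)) (hreg (p + q)) φ =
          cechMul hG (algebraMap (Polynomial ℂ) Fn p) (hreg p) φ +
            cechMul hG (algebraMap (Polynomial ℂ) Fn q) (hreg q) φ := by
        apply Subtype.ext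
        rw [Submodule.coe_add, coe_cechMul, coe_cechMul, coe_cechMul, map_add, add_smul]
      rw [h1, map_add, map_add, add_mul, ← hp, ← hq]
    | monomial n a =>
      induction n with
      | zero =>
        have h1 : cechMul hG (algebraMap (Polynomial ℂ) Fn (Polynomial.monomial 0 a))
            (hreg _) φ = a • φ := by
          apply Subtype.ext
          rw [coe_cechMul, Polynomial.monomial_zero_left, RatFunc.algebraMap_C,
            ← RatFunc.algebraMap_eq_C, algebraMap_smul]
          rfl
        rw [h1, map_smul, Polynomial.monomial_zero_left, RatFunc.algebraMap_C,
          RatFunc.smul_eq_C_mul]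
      | succ n ih =>
        have h1 : (Polynomial.monomial (n + 1) a : Polynomial ℂ) =
            Polynomial.X * Polynomial.monomial n a := by
          rw [Polynomial.X_mul_monomial]
        have h2 : cechMul hG (algebraMap (Polynomial ℂ) Fn (Polynomial.monomial (n + 1) a))
            (hreg _) φ =
              cechMul hG RatFunc.X (fun _ hx => X_mem_localRing (Set.inter_subset_left hx))
              (cechMul hG (algebraMap (Polynomial ℂ) Fn (Polynomial.monomial n a)) (hreg _) φ) := by
          apply Subtype.ext
          rw [coe_cechMul, coe_cechMul, coe_cechMul, smul_smul, h1, map_mul, RatFunc.algebraMap_X]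
        rw [h2, hL, ih, h1, map_mul, RatFunc.algebraMap_X, mul_assoc]
  let b₀ := finBasis Fn M
  choose s hs hsv _ using fun i => hG.exists_smul_mem_sections_chartZero (b₀ i)
  let b := b₀.unitsSMul fun i => Units.mk0 (s i) (hs i)
  have hb : ∀ i, b i ∈ sections G (chartZero ∩ chartInfty) := fun i => by
    have : b i = s i • b₀ i := by simp [b, Basis.unitsSMul_apply, Units.smul_def]
    rw [this]
    exact sections_mono G Set.inter_subset_left (hsv i)
  refine ⟨b.constr Fn fun i => L ⟨b i, hb i⟩, fun φ => ?_⟩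
  -- clear denominators in the coordinates of `φ`
  obtain ⟨d, hd⟩ := IsLocalization.exist_integer_multiples_of_finite
    (nonZeroDivisors (Polynomial ℂ)) (fun i => b.repr (φ : M) i)
  choose p hp using hd
  have hd0 : algebraMap (Polynomial ℂ) Fn d ≠ 0 :=
    RatFunc.algebraMap_ne_zero (nonZeroDivisors.ne_zero d.2)
  have h1 : cechMul hG (algebraMap (Polynomial ℂ) Fn d) (hreg d) φ =
      ∑ i, cechMul hG (algebraMap (Polynomial ℂ) Fn (p i)) (hreg (p i)) ⟨b i, hb i⟩ := by
    apply Subtype.ext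
    rw [coe_cechMul, AddSubmonoidClass.coe_finsetSum]
    conv_lhs => rw [← b.sum_repr (φ : M), Finset.smul_sum]
    refine Finset.sum_congr rfl fun i _ => ?_
    rw [coe_cechMul, hp, smul_smul, Algebra.smul_def]
  have h2 := congrArg L h1
  rw [hpoly, map_sum] at h2
  apply mul_left_cancel₀ hd0
  rw [h2, Basis.constr_apply_fintype, Finset.mul_sum]
  refine Finset.sum_congr rfl fun i _ => ?_
  rw [hpoly, hp, Algebra.smul_def (d : Polynomial ℂ), smul_eq_mul, ← mul_assoc,
    Basis.equivFun_apply]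

/-- Every functional on `H¹` comes from a global section of the Serre dual. -/
lemma serreMap_surjective [FiniteDimensional Fn M] (h : IsSerreDual B G' G)
    (hG : IsLatticeFamily G) (hB : Function.Surjective B) : Function.Surjective (serreMap h) := by
  intro l
  obtain ⟨L, hreg, hL⟩ := exists_laurent_lift hG l
  obtain ⟨l', hl'⟩ := exists_linear_extension hG L (fun φ => by
    refine eq_of_laurentCoeff_eq fun k => ?_
    have h1 : laurentCoeff k (RatFunc.X * L φ) = laurentCoeff (k - 1) (L φ) := by
      rw [← laurentCoeff_zpow_mul, zpow_one]
    rw [h1, hL, hL]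
    congr 2
    apply Subtype.ext
    rw [coe_cechMul, coe_cechMul, coe_cechMul, smul_smul, ← zpow_add_one₀ RatFunc.X_ne_zero]
    congr 2
    ring)
  obtain ⟨ψ, hψ⟩ := hB l'
  have hψ' : ∀ φ : Cech1 G, B ψ (φ : M) = L φ := fun φ => by rw [hψ, hl']
  have hmem : ψ ∈ sections G' Set.univ := by
    refine mem_sections.2 fun x _ => (h x ψ).2 fun v hv => ?_
    induction x using OnePoint.rec with
    | infty =>
      have hx : OnePoint.infty ∈ chartInfty := OnePoint.infty_ne_coe (0 : ℂ)
      obtain ⟨s, hs, hsv, hs'⟩ := hG.exists_smul_mem_sections_chartInfty v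
      let φ : Cech1 G := ⟨s • v, sections_mono G Set.inter_subset_right hsv⟩
      have h1 : tangentGen OnePoint.infty * L φ ∈ localRing OnePoint.infty := by
        refine (tangentGen_infty_mul_mem_iff (hreg φ)).2 fun k hk => ?_
        rw [hL, mk_eq_zero_of_mem_chartInfty, map_zero]
        exact zpow_smul_mem_chartInfty hG hsv (by omega)
      have h2 : tangentGen OnePoint.infty * B ψ v =
          s⁻¹ * (tangentGen OnePoint.infty * L φ) := by
        rw [← hψ', map_smul, smul_eq_mul]
        field_simp
      rw [h2]
      exact mul_mem (hs' _ hx hv) h1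
    | coe a =>
      have hx : (a : OnePoint ℂ) ∈ chartZero := OnePoint.coe_ne_infty a
      obtain ⟨s, hs, hsv, hs'⟩ := hG.exists_smul_mem_sections_chartZero v
      let φ : Cech1 G := ⟨s • v, sections_mono G Set.inter_subset_left hsv⟩
      have h1 : L φ ∈ localRing (a : OnePoint ℂ) := by
        by_cases ha : a = 0
        · rw [ha]
          refine mem_localRing_zero_of_laurentCoeff (hreg φ) fun k hk => ?_
          rw [hL, mk_eq_zero_of_mem_chartZero, map_zero]
          exact zpow_smul_mem_chartZero hG hsv (by omega)
        · exact hreg φ _ (coe_mem_overlap ha)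
      have h2 : tangentGen (a : OnePoint ℂ) * B ψ v = s⁻¹ * L φ := by
        rw [← hψ', map_smul, smul_eq_mul, show tangentGen (a : OnePoint ℂ) = 1 from rfl]
        field_simp
      rw [h2]
      exact mul_mem (hs' _ hx hv) h1
  refine ⟨⟨ψ, hmem⟩, ?_⟩
  apply Submodule.linearMap_qext
  ext φ
  change resZero (B ψ (φ : M)) = l (Submodule.Quotient.mk φ)
  rw [hψ', resZero_eq_laurentCoeff, hL]
  congr 2
  apply Subtype.ext
  rw [coe_cechMul, sub_self, zpow_zero, one_smul]

end Duality

end ProjLine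

/-! ### Local bases of vector bundles -/

namespace ProjLine

open Module

section LocalBases

variable {V : Type*} [AddCommGroup V] [Module Fn V] [Module ℂ V] [IsScalarTower ℂ Fn V]
  {m : ℕ}

instance (x : Pt) : IsFractionRing (localRing x) Fn where
  map_units := by
    rintro ⟨y, hy⟩
    have : (y : Fn) ≠ 0 := by simpa using nonZeroDivisors.ne_zero hy
    exact this.isUnit
  surj f := by
    rcases mem_or_inv_mem_localRing x f with h | h
    · exact ⟨(⟨f, h⟩, 1), by simp⟩
    · by_cases hf : f = 0
      · exact ⟨(0, 1), by simp [hf]⟩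
      · have h0 : (⟨f⁻¹, h⟩ : localRing x) ≠ 0 := fun h0 =>
          inv_ne_zero hf (congrArg Subtype.val h0)
        exact ⟨(1, ⟨⟨f⁻¹, h⟩, mem_nonZeroDivisors_of_ne_zero h0⟩), by
          change f * f⁻¹ = 1
          exact mul_inv_cancel₀ hf⟩
  exists_of_eq {a b} h := ⟨1, by rw [Subtype.ext h]⟩

/-- The basis `e` of the generic stalk spans the stalk of `E` at `x` over the local ring. -/
def IsLocalBasis (E : VectorBundle V) (x : Pt) (e : Basis (Fin m) Fn V) : Prop :=
  ∀ v, v ∈ E.germ x ↔ ∀ i, e.repr v i ∈ localRing x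

lemma isLocalBasis_of_stalk_eq_span {E : VectorBundle V} {x : Pt} {e : Basis (Fin m) Fn V}
    (h : E.stalk x = Submodule.span (localRing x) (Set.range e)) : IsLocalBasis E x e := by
  intro v
  change v ∈ E.stalk x ↔ _
  rw [h]
  exact (Basis.mem_span_iff_repr_mem (localRing x) e v).trans
    (forall_congr' fun i => by simp [Subalgebra.algebraMap_eq])

lemma exists_basis_of_stalk_eq_span [FiniteDimensional Fn V] (hm : finrank Fn V = m)
    {E : VectorBundle V} {x : Pt} {e : Fin m → V}
    (h : E.stalk x = Submodule.span (localRing x) (Set.range e)) :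
    ∃ e' : Basis (Fin m) Fn V, (∀ i, e' i = e i) ∧ IsLocalBasis E x e' := by
  have hspan : ⊤ ≤ Submodule.span Fn (Set.range e) := by
    rw [← E.span_eq_top x, h, Submodule.span_le]
    exact Submodule.span_subset_span (localRing x) Fn _
  have hcard : Fintype.card (Fin m) = finrank Fn V := by rw [hm, Fintype.card_fin]
  refine ⟨basisOfTopLeSpanOfCardEqFinrank e hspan hcard, fun i => by simp, ?_⟩
  apply isLocalBasis_of_stalk_eq_span
  rw [coe_basisOfTopLeSpanOfCardEqFinrank, h]

/-- Finitely generated torsion-free modules over the valuation ring `localRing x` are free. -/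
lemma exists_isLocalBasis [FiniteDimensional Fn V] (hm : finrank Fn V = m)
    (E : VectorBundle V) (x : Pt) : ∃ e : Basis (Fin m) Fn V, IsLocalBasis E x e := by
  have : Module.Finite (localRing x) (E.stalk x) := Module.Finite.of_fg (E.fg x)
  have htf : Module.IsTorsionFree (localRing x) V :=
    Module.IsTorsionFree.trans_faithfulSMul (localRing x) Fn V
  have : Module.Flat (localRing x) (E.stalk x) := by
    rw [Module.Flat.flat_iff_torsion_eq_bot_of_isBezout,
      ← Submodule.isTorsionFree_iff_torsion_eq_bot]
    infer_instance
  have : Module.Free (localRing x) (E.stalk x) := Module.free_of_flat_of_isLocalRing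
  let b := Module.finBasis (localRing x) (E.stalk x)
  let e : Fin (finrank (localRing x) (E.stalk x)) → V := fun i => b i
  have hli : LinearIndependent (localRing x) e :=
    b.linearIndependent.map' (E.stalk x).subtype (Submodule.ker_subtype _)
  have hli' : LinearIndependent Fn e := (LinearIndependent.iff_fractionRing (localRing x) Fn).1 hli
  have hspan : E.stalk x = Submodule.span (localRing x) (Set.range e) := by
    have h1 := congrArg (Submodule.map (E.stalk x).subtype) b.span_eq
    rw [Submodule.map_span, Submodule.map_top, Submodule.range_subtype, ← Set.range_comp] at h1
    exact h1.symm
  have hspan' : ⊤ ≤ Submodule.span Fn (Set.range e) := by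
    rw [← E.span_eq_top x, Submodule.span_le]
    exact fun v hv => Submodule.span_subset_span (localRing x) Fn _ (hspan.le hv)
  have hcard : finrank (localRing x) (E.stalk x) = m := by
    rw [← hm, finrank_eq_card_basis (Basis.mk hli' hspan'), Fintype.card_fin]
  have hr : Set.range (e ∘ finCongr hcard.symm) = Set.range e :=
    (finCongr hcard.symm).surjective.range_comp e
  obtain ⟨e', -, he'⟩ := exists_basis_of_stalk_eq_span hm (e := e ∘ finCongr hcard.symm)
    (hspan.trans (by rw [hr]))
  exact ⟨e', he'⟩

/-- Lifts of a basis of the fibre generate the stalk, by Nakayama's lemma. -/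
lemma exists_isLocalBasis_lifting [FiniteDimensional Fn V] (hm : finrank Fn V = m)
    (E : VectorBundle V) (x : Pt) (b : Basis (Fin m) ℂ (E.Fiber x)) :
    ∃ e : Basis (Fin m) Fn V, IsLocalBasis E x e ∧ ∀ i, ∃ h : e i ∈ E.germ x,
      ((E.vanishing x).submoduleOf (E.germ x)).mkQ ⟨e i, h⟩ = b i := by
  choose e he using fun i => Submodule.mkQ_surjective _ (b i)
  have hspan : E.stalk x = Submodule.span (localRing x) (Set.range fun i => (e i : V)) := by
    apply le_antisymm
    · refine Submodule.le_of_le_smul_of_le_jacobson_bot (E.fg x) (coordElt_mem_jacobson x) ?_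
      intro v hv
      let v' : E.germ x := ⟨v, hv⟩
      set a := b.repr (((E.vanishing x).submoduleOf (E.germ x)).mkQ v') with ha
      have h1 : ((E.vanishing x).submoduleOf (E.germ x)).mkQ (v' - ∑ i, a i • e i) = 0 := by
        rw [map_sub, map_sum, sub_eq_zero]
        conv_lhs => rw [← b.sum_repr (((E.vanishing x).submoduleOf (E.germ x)).mkQ v')]
        exact Finset.sum_congr rfl fun i _ => by rw [map_smul, he]
      rw [Submodule.mkQ_apply, Submodule.Quotient.mk_eq_zero] at h1
      obtain ⟨u, hu, hu'⟩ := h1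
      have h2 : v = ∑ i, a i • (e i : V) + coord x • u := by
        have : coord x • u = v - ∑ i, a i • (e i : V) := by
          refine hu'.trans ?_
          simp [v']
        rw [this]
        abel
      rw [h2]
      refine Submodule.add_mem_sup (sum_mem fun i _ => ?_) ?_
      · have : a i • (e i : V) = algebraMap ℂ (localRing x) (a i) • (e i : V) := by
          rw [algebraMap_smul]
        rw [this]
        exact Submodule.smul_mem _ _ (Submodule.subset_span ⟨i, rfl⟩)
      · exact Submodule.smul_mem_smul (Ideal.mem_span_singleton_self (coordElt x)) hu
    · rw [Submodule.span_le]
      rintro _ ⟨i, rfl⟩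
      exact (e i).2
  obtain ⟨e', he', hloc⟩ := exists_basis_of_stalk_eq_span hm hspan
  refine ⟨e', hloc, fun i => ?_⟩
  have h1 : e' i ∈ E.germ x := by rw [he']; exact (e i).2
  refine ⟨h1, ?_⟩
  rw [← he i]
  congr 1
  exact Subtype.ext (he' i)

lemma mem_vanishing_iff {E : VectorBundle V} {x : Pt} {e : Basis (Fin m) Fn V}
    (he : IsLocalBasis E x e) (v : V) :
    v ∈ E.vanishing x ↔ ∀ i, (coord x)⁻¹ * e.repr v i ∈ localRing x := by
  have h1 : v ∈ E.vanishing x ↔ (coord x)⁻¹ • v ∈ E.germ x := by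
    constructor
    · rintro ⟨w, hw, rfl⟩
      change (coord x)⁻¹ • coord x • w ∈ _
      rwa [smul_smul, inv_mul_cancel₀ (coord_ne_zero x), one_smul]
    · exact fun h => ⟨_, h, smul_inv_smul₀ (coord_ne_zero x) v⟩
  rw [h1, he]
  simp

/-- The values at `x` of the coordinates of a germ are the coordinates of its value in the fibre. -/
lemma exists_sub_C_repr_mem {E : VectorBundle V} {x : Pt} {e : Basis (Fin m) Fn V}
    (he : IsLocalBasis E x e) (b : Basis (Fin m) ℂ (E.Fiber x))
    (heb : ∀ i, ∃ h : e i ∈ E.germ x,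
      ((E.vanishing x).submoduleOf (E.germ x)).mkQ ⟨e i, h⟩ = b i) {v : V} (hv : v ∈ E.germ x)
    (i : Fin m) :
    (coord x)⁻¹ * (e.repr v i - RatFunc.C
      (b.repr (((E.vanishing x).submoduleOf (E.germ x)).mkQ ⟨v, hv⟩) i)) ∈ localRing x := by
  choose h h' using heb
  set a := b.repr (((E.vanishing x).submoduleOf (E.germ x)).mkQ ⟨v, hv⟩) with ha
  have h1 : ((E.vanishing x).submoduleOf (E.germ x)).mkQ
      (⟨v, hv⟩ - ∑ i, a i • ⟨e i, h i⟩) = 0 := by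
    rw [map_sub, map_sum, sub_eq_zero]
    conv_lhs => rw [← b.sum_repr (((E.vanishing x).submoduleOf (E.germ x)).mkQ ⟨v, hv⟩)]
    exact Finset.sum_congr rfl fun i _ => by rw [map_smul, h']
  rw [Submodule.mkQ_apply, Submodule.Quotient.mk_eq_zero] at h1
  have h2 : v - ∑ i, RatFunc.C (a i) • e i ∈ E.vanishing x := by
    have : ((⟨v, hv⟩ - ∑ i, a i • ⟨e i, h i⟩ : E.germ x) : V) =
        v - ∑ i, RatFunc.C (a i) • e i := by
      rw [Submodule.coe_sub, AddSubmonoidClass.coe_finsetSum]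
      congr 1
      refine Finset.sum_congr rfl fun i _ => ?_
      rw [← RatFunc.algebraMap_eq_C, algebraMap_smul]
      rfl
    rw [← this]
    exact h1
  have h3 := (mem_vanishing_iff he _).1 h2 i
  rwa [map_sub, Finsupp.sub_apply, Basis.repr_sum_self] at h3

end LocalBases

end ProjLine

/-! ### Parabolic and isomonodromic endomorphisms as weighted matrices -/

namespace ProjLine

open Module

section Weights

variable {V : Type*} [AddCommGroup V] [Module Fn V] {m : ℕ}

/-- The matrix entries of `φ` in the basis `e`, scaled by the weights `w`, are regular at `x`. -/
def HasRegularEntries (x : Pt) (e : Basis (Fin m) Fn V) (w : Fin m → Fin m → Fn)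
    (φ : Module.End Fn V) : Prop :=
  ∀ i j, w i j * e.repr (φ (e j)) i ∈ localRing x

lemma repr_apply_eq_sum (e : Basis (Fin m) Fn V) (φ : Module.End Fn V) (v : V) (i : Fin m) :
    e.repr (φ v) i = ∑ j, e.repr (φ (e j)) i * e.repr v j := by
  have h := LinearMap.toMatrix_mulVec_repr e e φ v
  rw [← h]
  simp [Matrix.mulVec, dotProduct, LinearMap.toMatrix_apply]

lemma trace_comp_eq_sum (e : Basis (Fin m) Fn V) (ψ φ : Module.End Fn V) :
    LinearMap.trace Fn V (ψ ∘ₗ φ) =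
      ∑ i, ∑ j, e.repr (ψ (e j)) i * e.repr (φ (e i)) j := by
  rw [LinearMap.trace_eq_matrix_trace Fn e, LinearMap.toMatrix_comp e e e, Matrix.trace]
  simp [Matrix.mul_apply, LinearMap.toMatrix_apply]

/-- The trace dual of a lattice given by weights on matrix entries is given by the inverse weights
on the transposed entries. -/
lemma hasRegularEntries_dual_iff {x : Pt} (e : Basis (Fin m) Fn V) {w : Fin m → Fin m → Fn}
    (hw : ∀ i j, w i j ≠ 0) (g : Fn) (ψ : Module.End Fn V) :
    HasRegularEntries x e (fun i j => g * (w j i)⁻¹) ψ ↔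
      ∀ φ, HasRegularEntries x e w φ →
        g * LinearMap.trace Fn V (ψ ∘ₗ φ) ∈ localRing x := by
  constructor
  · intro hψ φ hφ
    rw [trace_comp_eq_sum e, Finset.mul_sum]
    refine sum_mem fun i _ => ?_
    rw [Finset.mul_sum]
    refine sum_mem fun j _ => ?_
    have h1 : g * (e.repr (ψ (e j)) i * e.repr (φ (e i)) j) =
        (g * (w j i)⁻¹ * e.repr (ψ (e j)) i) * (w j i * e.repr (φ (e i)) j) := by
      have := hw j i
      field_simp
    rw [h1]
    exact mul_mem (hψ i j) (hφ j i)
  · intro h i j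
    -- test against the matrix unit at the transposed position
    let φ : Module.End Fn V := (w j i)⁻¹ • (e.coord i).smulRight (e j)
    have hφ : HasRegularEntries x e w φ := by
      intro k l
      have h1 : w k l * e.repr (φ (e l)) k = if l = i ∧ k = j then 1 else 0 := by
        by_cases hl : l = i
        · by_cases hk : k = j
          · simp [φ, hl, hk, hw]
          · simp [φ, hl, hk]
        · simp [φ, hl]
      rw [h1]
      split_ifs
      exacts [one_mem _, zero_mem _]
    have h2 : ψ ∘ₗ φ = (w j i)⁻¹ • (e.coord i).smulRight (ψ (e j)) := by
      ext v
      simp [φ]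
    have := Module.Free.of_basis e
    have := Module.Finite.of_basis e
    have h3 := h φ hφ
    rwa [h2, map_smul, LinearMap.trace_smulRight, Basis.coord_apply, smul_eq_mul, ← mul_assoc]
      at h3

lemma hasRegularEntries_smul {x : Pt} {e : Basis (Fin m) Fn V} {w : Fin m → Fin m → Fn} {f : Fn}
    {φ : Module.End Fn V} :
    HasRegularEntries x e w (f • φ) ↔ HasRegularEntries x e (fun i j => w i j * f) φ := by
  refine forall_congr' fun i => forall_congr' fun j => ?_
  rw [LinearMap.smul_apply, map_smul, Finsupp.smul_apply, smul_eq_mul, mul_assoc]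

variable [Module ℂ V]

/-- If `F k` consists of the germs in `E` whose coordinates of index less than `k` vanish at `x`,
then `φ` preserves `E` and maps every `F k` into `F (k + d)` iff its entries are regular and those
in row `i` and column `j` with `i < j + d` vanish at `x`. -/
lemma forall_mapsInto_iff {x : Pt} (e : Basis (Fin m) Fn V) (E : Submodule ℂ V)
    (F : ℕ → Submodule ℂ V) (hE : ∀ v, v ∈ E ↔ ∀ i, e.repr v i ∈ localRing x)
    (hF : ∀ k v, v ∈ F k ↔ v ∈ E ∧
      ∀ i : Fin m, (i : ℕ) < k → (coord x)⁻¹ * e.repr v i ∈ localRing x)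
    (d : ℕ) (φ : Module.End Fn V) :
    ((∀ v ∈ E, φ v ∈ E) ∧ ∀ k, ∀ v ∈ F k, φ v ∈ F (k + d)) ↔
      HasRegularEntries x e
        (fun i j => if (i : ℕ) < j + d then (coord x)⁻¹ else 1) φ := by
  have hone : ∀ j, e j ∈ E := fun j => (hE _).2 fun i => by
    rw [Basis.repr_self, Finsupp.single_apply]
    split_ifs
    exacts [one_mem _, zero_mem _]
  have hdiv : ∀ f, (coord x)⁻¹ * f ∈ localRing x → f ∈ localRing x := fun f hf => by
    have := mul_mem (coord_mem_localRing x) hf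
    rwa [mul_inv_cancel_left₀ (coord_ne_zero x)] at this
  constructor
  · rintro ⟨h1, h2⟩ i j
    dsimp only
    split_ifs with hij
    · have hj : e j ∈ F j := (hF _ _).2 ⟨hone j, fun l hl => by
        rw [Basis.repr_self, Finsupp.single_apply, if_neg, mul_zero]
        · exact zero_mem _
        · rintro rfl; exact lt_irrefl _ hl⟩
      exact ((hF _ _).1 (h2 j _ hj)).2 i hij
    · rw [one_mul]
      exact (hE _).1 (h1 _ (hone j)) i
  · intro h
    have hreg : ∀ i j, e.repr (φ (e j)) i ∈ localRing x := fun i j => by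
      have := h i j
      dsimp only at this
      split_ifs at this
      · exact hdiv _ this
      · rwa [one_mul] at this
    have h1 : ∀ v ∈ E, φ v ∈ E := fun v hv => (hE _).2 fun i => by
      rw [repr_apply_eq_sum e]
      exact sum_mem fun j _ => mul_mem (hreg i j) ((hE _).1 hv j)
    refine ⟨h1, fun k v hv => (hF _ _).2 ⟨h1 v ((hF _ _).1 hv).1, fun i hi => ?_⟩⟩
    rw [hF] at hv
    rw [repr_apply_eq_sum e, Finset.mul_sum]
    refine sum_mem fun j _ => ?_
    rcases lt_or_ge (j : ℕ) k with hj | hj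
    · rw [mul_left_comm]
      exact mul_mem (hreg i j) (hv.2 j hj)
    · rw [← mul_assoc]
      have := h i j
      dsimp only at this
      rw [if_pos (by omega)] at this
      exact mul_mem this ((hE _).1 hv.1 j)

variable [IsScalarTower ℂ Fn V]

/-- A family of lattices in `End V` that is given at every point by weights on matrix entries, with
trivial weights in a fixed basis at almost all points, is a lattice family. -/
lemma isLatticeFamily_of_hasRegularEntries {G : Pt → Submodule ℂ (Module.End Fn V)}
    (hG : ∀ x, ∃ (e : Basis (Fin m) Fn V) (w : Fin m → Fin m → Fn),
      ∀ φ, φ ∈ G x ↔ HasRegularEntries x e w φ)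
    (e₀ : Basis (Fin m) Fn V)
    (he₀ : {x | ¬ ∀ φ, φ ∈ G x ↔ HasRegularEntries x e₀ (fun _ _ => 1) φ}.Finite) :
    IsLatticeFamily G where
  smul_mem x f hf φ hφ := by
    obtain ⟨e, w, h⟩ := hG x
    rw [h] at hφ ⊢
    intro i j
    rw [LinearMap.smul_apply, map_smul, Finsupp.smul_apply, smul_eq_mul, mul_left_comm]
    exact mul_mem hf (hφ i j)
  absorbs x φ := by
    obtain ⟨e, w, h⟩ := hG x
    choose N hN using fun i j => exists_coord_pow_mul_mem x (w i j * e.repr (φ (e j)) i)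
    refine ⟨∑ i, ∑ j, N i j, (h _).2 fun i j => ?_⟩
    have hle : N i j ≤ ∑ i, ∑ j, N i j :=
      (Finset.single_le_sum (f := fun j => N i j) (fun _ _ => Nat.zero_le _)
        (Finset.mem_univ j)).trans
      (Finset.single_le_sum (f := fun i => ∑ j, N i j) (fun _ _ => Nat.zero_le _)
        (Finset.mem_univ i))
    obtain ⟨d, hd⟩ := Nat.exists_eq_add_of_le hle
    rw [LinearMap.smul_apply, map_smul, Finsupp.smul_apply, smul_eq_mul, mul_left_comm, hd,
      add_comm, pow_add, mul_assoc]
    exact mul_mem (pow_mem (coord_mem_localRing x) d) (hN i j)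
  generic φ := by
    have hfin : (⋃ i, ⋃ j, {x | e₀.repr (φ (e₀ j)) i ∉ localRing x}).Finite :=
      Set.finite_iUnion fun i => Set.finite_iUnion fun j => finite_not_mem_localRing _
    refine (he₀.union hfin).subset fun x hx => ?_
    by_contra hx'
    rw [Set.mem_union, not_or] at hx'
    apply hx
    rw [not_not.1 hx'.1 φ]
    intro i j
    rw [one_mul]
    by_contra hij
    exact hx'.2 (Set.mem_iUnion.2 ⟨i, Set.mem_iUnion.2 ⟨j, hij⟩⟩)

end Weights

section Parabolic

variable {V : Type*} [AddCommGroup V] [Module Fn V] [Module ℂ V] [IsScalarTower ℂ Fn V]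
  {m : ℕ} {ι : Type*} {E : VectorBundle V} {q : ι → Pt}

/-- With an eigenbasis of the residue, the flag consists of the vectors with vanishing initial
coordinates. -/
lemma mem_flag_iff (D : LogConnection E q) {μ : ι → Fin m → ℂ} {j : ι}
    (hμ : Function.Injective (μ j)) (b : Basis (Fin m) ℂ (E.Fiber (q j)))
    (hb : ∀ k, D.residue j (b k) = μ j k • b k) (k : ℕ) (y : E.Fiber (q j)) :
    y ∈ D.flag μ j k ↔ ∀ i : Fin m, (i : ℕ) < k → b.repr y i = 0 := by
  constructor
  · intro hy i hi
    have hle : D.flag μ j k ≤ LinearMap.ker (b.coord i) := by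
      refine iSup₂_le fun l hl z hz => ?_
      rw [Module.End.mem_eigenspace_iff] at hz
      have h1 : D.residue j z = ∑ a, (b.repr z a * μ j a) • b a := by
        conv_lhs => rw [← b.sum_repr z]
        rw [map_sum]
        exact Finset.sum_congr rfl fun a _ => by rw [map_smul, hb, smul_smul]
      have h2 := congrArg (fun u => b.repr u i) (h1.symm.trans hz)
      rw [Basis.repr_sum_self, map_smul, Finsupp.smul_apply, smul_eq_mul] at h2
      have h3 : (μ j i - μ j l) * b.repr z i = 0 := by linear_combination h2
      rcases mul_eq_zero.1 h3 with h4 | h4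
      · have : i = l := hμ (sub_eq_zero.1 h4)
        omega
      · exact h4
    exact hle hy
  · intro h
    rw [← b.sum_repr y]
    refine sum_mem fun i _ => ?_
    rcases lt_or_ge (i : ℕ) k with hi | hi
    · rw [h i hi, zero_smul]
      exact zero_mem _
    · refine Submodule.smul_mem _ _ ?_
      exact (le_iSup₂_of_le (f := fun (l' : Fin m) (_ : k ≤ (l' : ℕ)) =>
        (D.residue j).eigenspace (μ j l')) i hi le_rfl) (Module.End.mem_eigenspace_iff.2 (hb i))

lemma mem_flagGerm_iff (D : LogConnection E q) {μ : ι → Fin m → ℂ} {j : ι}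
    (hμ : Function.Injective (μ j)) (b : Basis (Fin m) ℂ (E.Fiber (q j)))
    (hb : ∀ k, D.residue j (b k) = μ j k • b k) {e : Basis (Fin m) Fn V}
    (he : IsLocalBasis E (q j) e) (heb : ∀ i, ∃ h : e i ∈ E.germ (q j),
      ((E.vanishing (q j)).submoduleOf (E.germ (q j))).mkQ ⟨e i, h⟩ = b i) (k : ℕ) (v : V) :
    v ∈ D.flagGerm μ j k ↔ v ∈ E.germ (q j) ∧
      ∀ i : Fin m, (i : ℕ) < k → (coord (q j))⁻¹ * e.repr v i ∈ localRing (q j) := by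
  rw [LogConnection.flagGerm, VectorBundle.mem_germsIn]
  have key : ∀ (hv : v ∈ E.germ (q j)) (i : Fin m),
      b.repr (((E.vanishing (q j)).submoduleOf (E.germ (q j))).mkQ ⟨v, hv⟩) i = 0 ↔
        (coord (q j))⁻¹ * e.repr v i ∈ localRing (q j) := by
    intro hv i
    have h1 := exists_sub_C_repr_mem he b heb hv i
    constructor
    · intro h2
      rwa [h2, map_zero, sub_zero] at h1
    · intro h2
      have h3 := sub_mem h2 h1
      rw [← mul_sub, sub_sub_cancel] at h3
      exact C_mem_coord_mul h3 (mul_inv_cancel_left₀ (coord_ne_zero _) _).symm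
  constructor
  · rintro ⟨hv, h⟩
    exact ⟨hv, fun i hi => (key hv i).1 ((mem_flag_iff D hμ b hb k _).1 h i hi)⟩
  · rintro ⟨hv, h⟩
    exact ⟨hv, (mem_flag_iff D hμ b hb k _).2 fun i hi => (key hv i).2 (h i hi)⟩

lemma mem_endPar_pole_iff (D : LogConnection E q) (hq : Function.Injective q)
    (μ : ι → Fin m → ℂ) (j : ι) (φ : Module.End Fn V) :
    φ ∈ D.endPar μ (q j) ↔ (∀ v ∈ E.germ (q j), φ v ∈ E.germ (q j)) ∧
      ∀ k, ∀ v ∈ D.flagGerm μ j k, φ v ∈ D.flagGerm μ j (k + 0) := by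
  rw [LogConnection.endPar, Submodule.mem_inf]
  refine and_congr Iff.rfl ?_
  simp only [Submodule.mem_iInf]
  exact ⟨fun h => h j rfl, fun h j' hj' => by rw [hq hj']; exact h⟩

lemma mem_endIso_pole_iff (D : LogConnection E q) (hq : Function.Injective q)
    (μ : ι → Fin m → ℂ) (j : ι) (φ : Module.End Fn V) :
    φ ∈ D.endIso μ (q j) ↔ (∀ v ∈ E.germ (q j), φ v ∈ E.germ (q j)) ∧
      ∀ k, ∀ v ∈ D.flagGerm μ j k, φ v ∈ D.flagGerm μ j (k + 1) := by
  rw [LogConnection.endIso, Submodule.mem_inf]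
  refine and_congr Iff.rfl ?_
  simp only [Submodule.mem_iInf]
  exact ⟨fun h => h j rfl, fun h j' hj' => by rw [hq hj']; exact h⟩

/-- Away from the poles the flags impose nothing: the two sheaves are the endomorphisms of the
bundle and the regular forms with values in them. -/
lemma mem_endPar_formsIso_of_not_pole (D : LogConnection E q) (μ : ι → Fin m → ℂ) {x : Pt}
    (hx : ∀ j, q j ≠ x) {e : Basis (Fin m) Fn V} (he : IsLocalBasis E x e)
    (φ : Module.End Fn V) :
    (φ ∈ D.endPar μ x ↔ HasRegularEntries x e (fun _ _ => 1) φ) ∧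
    (φ ∈ D.formsIso μ x ↔ HasRegularEntries x e (fun _ _ => tangentGen x * 1⁻¹) φ) := by
  have h0 : ∀ χ : Module.End Fn V, (∀ v ∈ E.germ x, χ v ∈ E.germ x) ↔
      HasRegularEntries x e (fun _ _ => 1) χ := by
    intro χ
    constructor
    · intro h i j
      rw [one_mul]
      refine (he _).1 (h _ ((he _).2 fun l => ?_)) i
      rw [Basis.repr_self, Finsupp.single_apply]
      split_ifs
      exacts [one_mem _, zero_mem _]
    · intro h v hv
      rw [he]
      intro i
      rw [repr_apply_eq_sum e]
      refine sum_mem fun j _ => mul_mem ?_ ((he _).1 hv j)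
      have := h i j
      rwa [one_mul] at this
  have hL : logField (Set.range q) x = tangentGen x := by
    rw [logField, if_neg]
    rintro ⟨j, hj⟩
    exact hx j hj
  constructor
  · rw [← h0, LogConnection.endPar, Submodule.mem_inf]
    simp only [Submodule.mem_iInf]
    exact ⟨fun h => h.1, fun h => ⟨h, fun j hj => absurd hj (hx j)⟩⟩
  · have h1 : (fun _ _ => tangentGen x * 1⁻¹ : Fin m → Fin m → Fn) =
        fun i j => (fun _ _ => 1 : Fin m → Fin m → Fn) i j * tangentGen x := by
      ext; simp
    rw [h1, ← hasRegularEntries_smul, ← h0, LogConnection.formsIso, Submodule.mem_comap, hL,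
      LogConnection.endIso, Submodule.mem_inf]
    simp only [Submodule.mem_iInf]
    exact ⟨fun h => h.1, fun h => ⟨h, fun j hj => absurd hj (hx j)⟩⟩

/-- The germs of both sheaves are described by mutually dual weights in a suitable local basis:
at a pole, a basis lifting the eigenbasis of the residue. -/
lemma exists_weights [FiniteDimensional Fn V] (hm : finrank Fn V = m) (D : LogConnection E q)
    (hq : Function.Injective q) {μ : ι → Fin m → ℂ} (hμ : ∀ j, Function.Injective (μ j))
    (hres : ∀ j, ∃ b : Basis (Fin m) ℂ (E.Fiber (q j)), ∀ k, D.residue j (b k) = μ j k • b k)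
    (x : Pt) :
    ∃ (e : Basis (Fin m) Fn V) (w : Fin m → Fin m → Fn), (∀ i j, w i j ≠ 0) ∧
      (∀ φ, φ ∈ D.endPar μ x ↔ HasRegularEntries x e w φ) ∧
      ∀ ψ, ψ ∈ D.formsIso μ x ↔ HasRegularEntries x e (fun i j => tangentGen x * (w j i)⁻¹) ψ := by
  by_cases hx : ∃ j, q j = x
  · obtain ⟨j, rfl⟩ := hx
    obtain ⟨b, hb⟩ := hres j
    obtain ⟨e, he, heb⟩ := exists_isLocalBasis_lifting hm E (q j) b
    have hF := mem_flagGerm_iff D (hμ j) b hb he heb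
    have hc := coord_ne_zero (q j)
    refine ⟨e, fun i l => if (i : ℕ) < l + 0 then (coord (q j))⁻¹ else 1, ?_, ?_, ?_⟩
    · intro i l
      dsimp only
      split_ifs
      exacts [inv_ne_zero hc, one_ne_zero]
    · intro φ
      rw [mem_endPar_pole_iff D hq]
      exact forall_mapsInto_iff e _ _ he hF 0 φ
    · intro ψ
      rw [LogConnection.formsIso, Submodule.mem_comap, mem_endIso_pole_iff D hq]
      refine (forall_mapsInto_iff e _ _ he hF 1 _).trans ?_
      refine Iff.trans hasRegularEntries_smul (Iff.of_eq ?_)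
      congr 1
      funext i l
      have hL : logField (Set.range q) (q j) = coord (q j) * tangentGen (q j) := by
        rw [logField, if_pos ⟨j, rfl⟩]
      rw [hL]
      dsimp only
      by_cases h : (i : ℕ) ≤ l
      · rw [if_pos (by omega), if_neg (by omega)]
        field_simp
      · rw [if_neg (by omega), if_pos (by omega)]
        field_simp
  · obtain ⟨e, he⟩ := exists_isLocalBasis hm E x
    have := mem_endPar_formsIso_of_not_pole D μ (not_exists.1 hx) he
    exact ⟨e, fun _ _ => 1, fun _ _ => one_ne_zero, fun φ => (this φ).1, fun φ => (this φ).2⟩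

end Parabolic

end ProjLine

/-! ### Adjointness and the duality of kernel and cokernel -/

namespace ProjLine

open Module

section TraceForm

variable {V : Type*} [AddCommGroup V] [Module Fn V]

/-- The trace form `(ψ, φ) ↦ tr (ψ φ)` on endomorphisms of the generic stalk. -/
noncomputable def traceForm (V : Type*) [AddCommGroup V] [Module Fn V] :
    LinearMap.BilinForm Fn (Module.End Fn V) :=
  (LinearMap.mul Fn (Module.End Fn V)).compr₂ (LinearMap.trace Fn V)

lemma traceForm_apply (ψ φ : Module.End Fn V) :
    traceForm V ψ φ = LinearMap.trace Fn V (ψ ∘ₗ φ) := rfl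

lemma traceForm_bijective [FiniteDimensional Fn V] : Function.Bijective (traceForm V) := by
  have hinj : Function.Injective (traceForm V) := by
    rw [injective_iff_map_eq_zero]
    intro ψ hψ
    let e := finBasis Fn V
    refine e.ext fun j => e.ext_elem fun i => ?_
    have h1 : ψ ∘ₗ (e.coord i).smulRight (e j) = (e.coord i).smulRight (ψ (e j)) := by
      ext v
      simp
    have h2 := LinearMap.congr_fun hψ ((e.coord i).smulRight (e j))
    rw [traceForm_apply, h1, LinearMap.trace_smulRight] at h2
    simpa using h2
  exact ⟨hinj, (LinearMap.injective_iff_surjective_of_finrank_eq_finrank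
    Subspace.dual_finrank_eq.symm).1 hinj⟩

variable [Module ℂ V] [IsScalarTower ℂ Fn V] {m : ℕ} {ι : Type*} {E : VectorBundle V}
  {q : ι → Pt}

lemma trace_mem_localRing [FiniteDimensional Fn V] {x : Pt} {φ : Module.End Fn V}
    (hφ : ∀ v ∈ E.germ x, φ v ∈ E.germ x) : LinearMap.trace Fn V φ ∈ localRing x := by
  obtain ⟨e, he⟩ := exists_isLocalBasis rfl E x
  rw [LinearMap.trace_eq_matrix_trace Fn e, Matrix.trace]
  refine sum_mem fun i _ => ?_
  rw [Matrix.diag_apply, LinearMap.toMatrix_apply]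
  refine (he _).1 (hφ _ ((he _).2 fun l => ?_)) i
  rw [Basis.repr_self, Finsupp.single_apply]
  split_ifs
  exacts [one_mem _, zero_mem _]

/-- The trace carries the connection on endomorphisms to `d/dz`: the connection matrix contributes
a commutator, which has no trace. -/
lemma trace_ad [FiniteDimensional Fn V] (D : LogConnection E q) (φ : Module.End Fn V) :
    LinearMap.trace Fn V (D.ad φ) = ddz (LinearMap.trace Fn V φ) := by
  let e := finBasis Fn V
  let A : Module.End Fn V := e.constr Fn fun j => D.nabla (e j)
  let φ' : Module.End Fn V := e.constr Fn fun j => ∑ i, ddz (e.repr (φ (e j)) i) • e i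
  have hA : ∀ v, D.nabla v = ∑ i, ddz (e.repr v i) • e i + A v := by
    intro v
    conv_lhs => rw [← e.sum_repr v]
    rw [map_sum, Basis.constr_apply_fintype, ← Finset.sum_add_distrib]
    exact Finset.sum_congr rfl fun i _ => D.leibniz _ _
  have h1 : D.ad φ = φ' + (A * φ - φ * A) := by
    refine e.ext fun j => ?_
    change D.nabla (φ (e j)) - φ (D.nabla (e j)) = φ' (e j) + (A (φ (e j)) - φ (A (e j)))
    rw [hA, Basis.constr_basis, Basis.constr_basis, add_sub_assoc]
  rw [h1, map_add, map_sub, LinearMap.trace_mul_comm, sub_self, add_zero,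
    LinearMap.trace_eq_matrix_trace Fn e, LinearMap.trace_eq_matrix_trace Fn e, Matrix.trace,
    Matrix.trace, map_sum]
  refine Finset.sum_congr rfl fun i _ => ?_
  rw [Matrix.diag_apply, Matrix.diag_apply, LinearMap.toMatrix_apply, LinearMap.toMatrix_apply,
    Basis.constr_basis, Basis.repr_sum_self]

lemma trace_ad_comp_add [FiniteDimensional Fn V] (D : LogConnection E q)
    (φ χ : Module.End Fn V) :
    LinearMap.trace Fn V (D.ad φ ∘ₗ χ) + LinearMap.trace Fn V (φ ∘ₗ D.ad χ) =
      ddz (LinearMap.trace Fn V (φ ∘ₗ χ)) := by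
  rw [← trace_ad D, ← map_add]
  congr 1
  ext v
  change D.nabla (φ (χ v)) - φ (D.nabla (χ v)) + φ (D.nabla (χ v) - χ (D.nabla v)) =
    D.nabla (φ (χ v)) - φ (χ (D.nabla v))
  rw [map_sub]
  abel

/-- `H⁰(D)` and `-H¹(D)` are adjoint for the residue pairing. -/
lemma resZero_trace_ad_comp [FiniteDimensional Fn V] (D : LogConnection E q) (μ : ι → Fin m → ℂ)
    (φ : H0 (D.endPar μ)) (χ : Cech1 (D.endPar μ)) :
    resZero (LinearMap.trace Fn V (D.ad (φ : Module.End Fn V) ∘ₗ (χ : Module.End Fn V))) =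
      -resZero (LinearMap.trace Fn V
        ((φ : Module.End Fn V) ∘ₗ D.ad (χ : Module.End Fn V))) := by
  rw [eq_neg_iff_add_eq_zero, resZero_eq_laurentCoeff, resZero_eq_laurentCoeff, ← map_add,
    trace_ad_comp_add, ← resZero_eq_laurentCoeff]
  refine resZero_ddz fun x hx => trace_mem_localRing (E := E) fun v hv => ?_
  exact (mem_sections.1 φ.2 x trivial).1 _ ((mem_sections.1 χ.2 x hx).1 v hv)

section Duals

variable [FiniteDimensional Fn V] (hm : finrank Fn V = m) (D : LogConnection E q)
  (hq : Function.Injective q) {μ : ι → Fin m → ℂ} (hμ : ∀ j, Function.Injective (μ j))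
  (hres : ∀ j, ∃ b : Basis (Fin m) ℂ (E.Fiber (q j)), ∀ k, D.residue j (b k) = μ j k • b k)

include hm hq hμ hres

lemma isSerreDual_formsIso_endPar :
    IsSerreDual (traceForm V) (D.formsIso μ) (D.endPar μ) := by
  intro x ψ
  obtain ⟨e, w, hw, h1, h2⟩ := exists_weights hm D hq hμ hres x
  rw [h2, hasRegularEntries_dual_iff e hw]
  exact forall_congr' fun φ => by rw [h1]; rfl

lemma isSerreDual_endPar_formsIso :
    IsSerreDual (traceForm V) (D.endPar μ) (D.formsIso μ) := by
  intro x ψ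
  obtain ⟨e, w, hw, h1, h2⟩ := exists_weights hm D hq hμ hres x
  have hg := tangentGen_ne_zero x
  have hw' : w = fun i j => tangentGen x * (tangentGen x * (w i j)⁻¹)⁻¹ := by
    funext i j
    have := hw i j
    field_simp
  rw [h1, hw', hasRegularEntries_dual_iff (w := fun i j => tangentGen x * (w j i)⁻¹) e
    (fun i j => mul_ne_zero hg (inv_ne_zero (hw j i)))]
  exact forall_congr' fun φ => by rw [h2]; rfl

lemma isLatticeFamily_endPar_and_formsIso [Finite ι] :
    IsLatticeFamily (D.endPar μ) ∧ IsLatticeFamily (D.formsIso μ) := by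
  subst hm
  obtain ⟨e₀, he₀⟩ := E.generic
  have hfin : (({x : Pt | E.stalk x ≠ Submodule.span (localRing x) (Set.range e₀)} ∪
      Set.range q) ∪ {OnePoint.infty}).Finite :=
    (he₀.union (Set.finite_range q)).union (Set.finite_singleton _)
  have hgood : ∀ x, x ∉ (({x : Pt | E.stalk x ≠ Submodule.span (localRing x) (Set.range e₀)} ∪
      Set.range q) ∪ {OnePoint.infty}) → ∀ φ,
      (φ ∈ D.endPar μ x ↔ HasRegularEntries x e₀ (fun _ _ => 1) φ) ∧
      (φ ∈ D.formsIso μ x ↔ HasRegularEntries x e₀ (fun _ _ => 1) φ) := by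
    intro x hx φ
    rw [Set.mem_union, Set.mem_union, not_or, not_or] at hx
    have h1 := mem_endPar_formsIso_of_not_pole D μ (fun j hj => hx.1.2 ⟨j, hj⟩)
      (isLocalBasis_of_stalk_eq_span (not_not.1 hx.1.1)) φ
    have h2 : tangentGen x = 1 := by
      induction x using OnePoint.rec with
      | infty => exact absurd rfl hx.2
      | coe a => rfl
    rwa [h2, inv_one, mul_one] at h1
  constructor
  · refine isLatticeFamily_of_hasRegularEntries (fun x => ?_) e₀ (hfin.subset fun x hx => ?_)
    · obtain ⟨e, w, hw, h1, h2⟩ := exists_weights rfl D hq hμ hres x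
      exact ⟨e, w, h1⟩
    · by_contra h
      exact hx fun φ => (hgood x h φ).1
  · refine isLatticeFamily_of_hasRegularEntries (fun x => ?_) e₀ (hfin.subset fun x hx => ?_)
    · obtain ⟨e, w, hw, h1, h2⟩ := exists_weights rfl D hq hμ hres x
      exact ⟨e, _, h2⟩
    · by_contra h
      exact hx fun φ => (hgood x h φ).2

end Duals

end TraceForm

/-- If `S` is adjoint to `-T` under a duality of `A` with `B` and a map from `A'` onto the dual of
`B'`, then the cokernel of `S` is dual to the kernel of `T`: a functional vanishing on the kernel of
`T` factors through `T`.  No finiteness of dimensions is needed. -/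
lemma exists_coker_equiv_dual_ker {A A' B B' : Type*} [AddCommGroup A] [Module ℂ A]
    [AddCommGroup A'] [Module ℂ A'] [AddCommGroup B] [Module ℂ B] [AddCommGroup B'] [Module ℂ B']
    (S : A' →ₗ[ℂ] A) (T : B →ₗ[ℂ] B') (P : A →ₗ[ℂ] Dual ℂ B) (Q : A' →ₗ[ℂ] Dual ℂ B')
    (hP : Function.Bijective P) (hQ : Function.Surjective Q)
    (hadj : ∀ a, P (S a) = -T.dualMap (Q a)) :
    ∃ e : (A ⧸ LinearMap.range S) ≃ₗ[ℂ] Dual ℂ (LinearMap.ker T),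
      ∀ a b, e (Submodule.Quotient.mk a) b = P a b := by
  let R : A →ₗ[ℂ] Dual ℂ (LinearMap.ker T) := (LinearMap.ker T).subtype.dualMap ∘ₗ P
  have hR : Function.Surjective R :=
    (LinearMap.dualMap_surjective_of_injective (Submodule.injective_subtype _)).comp hP.2
  have hker : LinearMap.range S = LinearMap.ker R := by
    ext a
    constructor
    · rintro ⟨a', rfl⟩
      ext b
      change P (S a') b = 0
      rw [hadj]
      change -(Q a' (T b)) = 0
      rw [b.2, map_zero, neg_zero]
    · intro ha
      have h1 : P a ∈ (LinearMap.ker T).dualAnnihilator := by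
        rw [Submodule.mem_dualAnnihilator]
        exact fun b hb => LinearMap.congr_fun ha ⟨b, hb⟩
      rw [← LinearMap.range_dualMap_eq_dualAnnihilator_ker] at h1
      obtain ⟨l, hl⟩ := h1
      obtain ⟨a', rfl⟩ := hQ l
      refine ⟨-a', hP.1 ?_⟩
      rw [map_neg, map_neg, hadj, neg_neg, hl]
  exact ⟨(Submodule.quotEquivOfEq _ _ hker).trans (R.quotKerEquivOfSurjective hR),
    fun a b => rfl⟩

lemma poles_injective {n : ℕ} {p : Fin n → ℂ} (hp : Function.Injective p) :
    Function.Injective (poles p) := by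
  refine Fin.cons_injective_iff.2 ⟨?_, OnePoint.coe_injective.comp hp⟩
  rintro ⟨j, hj⟩
  exact OnePoint.coe_ne_infty _ hj

end ProjLine

theorem mainTheorem4 {n m : ℕ} (p : Fin n → ℂ) (hp : Function.Injective p)
    {V : Type*} [AddCommGroup V] [Module ProjLine.Fn V] [Module ℂ V]
    [IsScalarTower ℂ ProjLine.Fn V] [FiniteDimensional ProjLine.Fn V]
    (hm : Module.finrank ProjLine.Fn V = m)
    (E : ProjLine.VectorBundle V) (D : ProjLine.LogConnection E (ProjLine.poles p))
    (μ : Fin (n + 1) → Fin m → ℂ) (hμ : ∀ j, Function.Injective (μ j))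
    (hres : ∀ j, ∃ b : Module.Basis (Fin m) ℂ (E.Fiber (ProjLine.poles p j)),
      ∀ k, D.residue j (b k) = μ j k • b k) :
    ∃ e : Module.Dual ℂ (D.K μ) ≃ₗ[ℂ] D.C μ,
      ∀ (ψ : ProjLine.H0 (D.formsIso μ)) (φ : ProjLine.Cech1 (D.endPar μ))
        (hφ : (Submodule.Quotient.mk φ : ProjLine.H1 (D.endPar μ)) ∈ D.K μ),
        e.symm (Submodule.Quotient.mk ψ) ⟨Submodule.Quotient.mk φ, hφ⟩ =
          ProjLine.serrePairing m (ψ : Module.End ProjLine.Fn V) φ := by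
  open ProjLine in
  have hq := poles_injective hp
  have h1 := isSerreDual_formsIso_endPar hm D hq hμ hres
  have h2 := isSerreDual_endPar_formsIso hm D hq hμ hres
  obtain ⟨hE, hF⟩ := isLatticeFamily_endPar_and_formsIso hm D hq hμ hres
  have hB := traceForm_bijective (V := V)
  obtain ⟨e, he⟩ := exists_coker_equiv_dual_ker (D.H0D μ) (D.H1D μ) (serreMap h1) (serreMap h2)
    ⟨serreMap_injective h1 hE hB.1, serreMap_surjective h1 hE hB.2⟩
    (serreMap_surjective h2 hF hB.2) (fun φ => by
      apply Submodule.linearMap_qext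
      ext χ
      exact resZero_trace_ad_comp D μ φ χ)
  -- the trace vanishes identically in rank `0`, so any nonzero scalar can replace `1 / m` there
  obtain ⟨c, hc, hcm⟩ : ∃ c : ℂ, c ≠ 0 ∧ ∀ f : Module.End Fn V,
      c * resZero (LinearMap.trace Fn V f) = 1 / (m : ℂ) * resZero (LinearMap.trace Fn V f) := by
    rcases Nat.eq_zero_or_pos m with rfl | hpos
    · have : Subsingleton V := Module.finrank_zero_iff.1 hm
      refine ⟨1, one_ne_zero, fun f => ?_⟩
      rw [Subsingleton.elim f 0, map_zero, resZero_eq_laurentCoeff, map_zero, mul_zero, mul_zero]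
    · exact ⟨1 / m, one_div_ne_zero (Nat.cast_ne_zero.2 hpos.ne'), fun f => rfl⟩
  refine ⟨(e.trans (LinearEquiv.smulOfNeZero ℂ _ c hc)).symm, fun ψ φ hφ => ?_⟩
  exact (congrArg (c * ·) (he ψ ⟨_, hφ⟩)).trans (hcm _)
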